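/- Let $T>0$, $s_0>0$, $\sigma>0$, $\mu\in\mathbb{R}$. Let $(\Omega,\mathcal F,\mathbf P)$ be a complete probability space with a standard Brownian motion $W=(W_t)_{t\in[0,T]}$ (with a.s. continuous paths), let $$S_t=s_0\,e^{\mu t+\sigma W_t-\frac12\sigma^2t},\qquad t\in[0,T],$$ be the discounted Black--Scholes stock price, and let $(\mathcal F_t)_{t\in[0,T]}$ be the filtration generated by $S$, augmented by the null sets and made right-continuous. A portfolio is an adapted pair $\mathbf\Phi=(\Phi^0,\Phi)$ (bonds, shares) with value $V_t(\mathbf\Phi)=\Phi^0_t+\Phi_tS_t$. It is *almost simple* if there are nondecreasing $[0,T]$-valued stopping times $(\tau_k)_{k\ge0}$ with $\mathbf P[\exists k:\tau_k=T]=1$, an $\mathbb N$-valued random variable $N$ and $\mathcal F_{\tau_k}$-measurable $\phi_k,\phi^0_k$ such that a.s. $\Phi_t=\sum_{k=0}^{N-1}\phi_k\mathbf 1_{(\tau_k,\tau_{k+1}]}(t)$ and $\Phi^0_t=\sum_{k=0}^{N-1}\phi^0_k\mathbf 1_{(\tau_k,\tau_{k+1}]}(t)$ for all $t\in[0,T]$.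 It is *simple* if this holds with a deterministic $N=n$ and finitely many stopping times $0\le\tau_0\le\dots\le\tau_n\le T$, continued by $\tau_k=T$ for $k>n$. Such a portfolio is *self-financing* if, for all $k$, a.s. $V_{\tau_{k+1}}(\mathbf\Phi)-V_{\tau_k}(\mathbf\Phi)=\Phi_{\tau_{k+1}}(S_{\tau_{k+1}}-S_{\tau_k})$. Let $\mathcal A^{\mathrm{si}}$ and $\mathcal A^{\mathrm{as}}$ be the classes of self-financing simple and almost simple portfolios. A portfolio with $V_0(\mathbf\Phi)=0$ is *arbitrage* if $V_T(\mathbf\Phi)\ge0$ a.s. and $\mathbf P[V_T(\mathbf\Phi)>0]>0$, and *strong arbitrage* if $V_T(\mathbf\Phi)\ge a$ a.s. for some constant $a>0$. A sequence $(\mathbf\Phi^n)$ with $V_0(\mathbf\Phi^n)=0$ for all $n$ is *approximate arbitrage* if $V_T(\mathbf\Phi^n)$ converges in probability to some $V_T^\infty$ with $V^\infty_T\ge0$ a.s. and $\mathbf P[V^\infty_T>0]>0$; it is *strong* approximate arbitrage if moreover $V^\infty_T\ge a$ a.s. for some constant $a>0$. Then: 1. there is no arbitrage in $\mathcal A^{\mathrm{si}}$;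 2. there is strong approximate arbitrage in $\mathcal A^{\mathrm{si}}$, that is, by a sequence of portfolios in $\mathcal A^{\mathrm{si}}$; 3. there is strong arbitrage in $\mathcal A^{\mathrm{as}}$; 4. the arbitrages in 2 and 3 are given by a doubling strategy: with $t_k=T(1-2^{-k})$, there are constants $c_k>0$ such that, for $$\tau=\inf\Big\{t_k:\ k\ge1,\ \frac{S_{t_k}-S_{t_{k-1}}}{S_{t_{k-1}}}\ge c_k\Big\}\quad(\inf\emptyset:=T),$$ there is a strong arbitrage $\mathbf\Phi\in\mathcal A^{\mathrm{as}}$ with $$\Phi_t=\sum_{k=0}^\infty\phi_{t_k}\mathbf 1_{(t_k\wedge\tau,\,t_{k+1}\wedge\tau]}(t),\qquad \phi_{t_k}=\frac{1-V_{t_k}(\mathbf\Phi)}{S_{t_k}c_{k+1}},$$ and portfolios $\mathbf\Phi^n\in\mathcal A^{\mathrm{si}}$ with $\Phi^n_t=\sum_{k=0}^n\phi_{t_k}\mathbf 1_{(t_k\wedge\tau,\,t_{k+1}\wedge\tau]}(t)$ that form a strong approximate arbitrage. -/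

import Mathlib

open MeasureTheory ProbabilityTheory Filter Set
open scoped Topology

namespace BlackScholes

variable {Ω : Type*} {m : MeasurableSpace Ω} {T : ℝ}

/-- The trading period `[0, T]`. -/
abbrev Time (T : ℝ) : Type := Set.Icc (0 : ℝ) T

/-- The initial time `0`. -/
def initialTime (hT : 0 ≤ T) : Time T := ⟨0, le_rfl, hT⟩

/-- The maturity `T`. -/
def maturity (hT : 0 ≤ T) : Time T := ⟨T, hT, le_rfl⟩

/-! ### The model -/

/-- `W` is a standard Brownian motion on `[0, T]`: a centered Gaussian process with `W 0 = 0`,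
covariance `min s t`, and almost surely continuous paths. -/
structure IsBrownianMotion (P : Measure Ω) (hT : 0 ≤ T) (W : Time T → Ω → ℝ) : Prop where
  measurable : ∀ t, Measurable (W t)
  gaussian : IsGaussianProcess W P
  zero : ∀ᵐ ω ∂P, W (initialTime hT) ω = 0
  centered : ∀ t, ∫ ω, W t ω ∂P = 0
  covariance : ∀ s t, cov[W s, W t; P] = min (s : ℝ) (t : ℝ)
  continuous : ∀ᵐ ω ∂P, Continuous fun t => W t ω

/-- The discounted stock price `S_t = s₀ exp(μ t + σ W_t - σ² t / 2)`. -/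
noncomputable def price (s₀ μ σ : ℝ) (W : Time T → Ω → ℝ) (t : Time T) (ω : Ω) : ℝ :=
  s₀ * Real.exp (μ * t + σ * W t ω - σ ^ 2 * t / 2)

theorem measurable_price (s₀ μ σ : ℝ) {W : Time T → Ω → ℝ} (hW : ∀ t, Measurable (W t))
    (t : Time T) : Measurable (price s₀ μ σ W t) := by
  have := hW t
  unfold price
  fun_prop

/-- The usual augmentation of a filtration: adjoin all null sets, then make it right-continuous
(at the final time `T` nothing is changed by the second step). -/
noncomputable def usualAugmentation (P : Measure Ω) [P.IsComplete]
    (𝓖 : Filtration (Time T) m) : Filtration (Time T) m :=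
  (𝓖 ⊔ Filtration.const (Time T) (MeasurableSpace.generateFrom {s : Set Ω | P s = 0})
    (MeasurableSpace.generateFrom_le fun s hs => Measure.IsComplete.out' s hs)).rightCont

/-- The filtration generated by the stock price, augmented to satisfy the usual conditions. -/
noncomputable def priceFiltration (P : Measure Ω) [P.IsComplete] (s₀ μ σ : ℝ)
    (W : Time T → Ω → ℝ) (hW : ∀ t, Measurable (W t)) : Filtration (Time T) m :=
  usualAugmentation P
    (Filtration.natural (price s₀ μ σ W) fun t => (measurable_price s₀ μ σ hW t).stronglyMeasurable)

/-! ### Portfolios -/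

/-- A portfolio: an adapted pair (number of bonds, number of shares). -/
structure Portfolio (𝓕 : Filtration (Time T) m) where
  bond : Time T → Ω → ℝ
  stock : Time T → Ω → ℝ
  adapted_bond : Adapted 𝓕 bond
  adapted_stock : Adapted 𝓕 stock

variable {𝓕 : Filtration (Time T) m}

/-- The value `V_t(Φ) = Φ⁰_t + Φ_t S_t`. -/
def Portfolio.value (Φ : Portfolio 𝓕) (S : Time T → Ω → ℝ) (t : Time T) (ω : Ω) : ℝ :=
  Φ.bond t ω + Φ.stock t ω * S t ω

/-- Both components of `Φ` are of the form `∑_{k < N} φ_k 1_{(τ_k, τ_{k+1}]}` for nondecreasing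
`[0, T]`-valued stopping times `τ_k` and `𝓕_{τ_k}`-measurable `φ_k`. -/
def Portfolio.IsStepAlong (Φ : Portfolio 𝓕) (P : Measure Ω) (τ : ℕ → Ω → Time T)
    (N : Ω → ℕ) : Prop :=
  (∀ ω, Monotone fun k => τ k ω) ∧
  ∃ hτ : ∀ k, IsStoppingTime 𝓕 (fun ω => (τ k ω : WithTop (Time T))),
  ∃ φ₀ φ : ℕ → Ω → ℝ,
    (∀ k, Measurable[(hτ k).measurableSpace] (φ₀ k)) ∧
    (∀ k, Measurable[(hτ k).measurableSpace] (φ k)) ∧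
    (∀ᵐ ω ∂P, ∀ t, Φ.bond t ω =
      ∑ k ∈ Finset.range (N ω), (Set.Ioc (τ k ω) (τ (k + 1) ω)).indicator (fun _ => φ₀ k ω) t) ∧
    (∀ᵐ ω ∂P, ∀ t, Φ.stock t ω =
      ∑ k ∈ Finset.range (N ω), (Set.Ioc (τ k ω) (τ (k + 1) ω)).indicator (fun _ => φ k ω) t)

/-- The self-financing condition along the readjustment times `τ_k`. -/
def Portfolio.IsSelfFinancingAlong (Φ : Portfolio 𝓕) (P : Measure Ω) (S : Time T → Ω → ℝ)
    (τ : ℕ → Ω → Time T) : Prop :=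
  ∀ k, ∀ᵐ ω ∂P, Φ.value S (τ (k + 1) ω) ω - Φ.value S (τ k ω) ω =
    Φ.stock (τ (k + 1) ω) ω * (S (τ (k + 1) ω) ω - S (τ k ω) ω)

/-- The self-financing simple portfolios, with finitely many stopping times `τ_0 ≤ ⋯ ≤ τ_n ≤ T`.
The finite list is continued by `τ_k = T` for `k > n`, so that the self-financing condition for
`k = n` says that no value is lost or created when the positions are closed at `τ_n < T`. -/
def simple (P : Measure Ω) (𝓕 : Filtration (Time T) m) (hT : 0 ≤ T) (S : Time T → Ω → ℝ) :
    Set (Portfolio 𝓕) :=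
  {Φ | ∃ (n : ℕ) (τ : ℕ → Ω → Time T), (∀ k, n < k → ∀ ω, τ k ω = maturity hT) ∧
    Φ.IsStepAlong P τ (fun _ => n) ∧ Φ.IsSelfFinancingAlong P S τ}

/-- The self-financing almost simple portfolios: a sequence of stopping times that almost surely
reaches `T`, and an `ℕ`-valued random number `N` of summands. -/
def almostSimple (P : Measure Ω) (𝓕 : Filtration (Time T) m) (hT : 0 ≤ T)
    (S : Time T → Ω → ℝ) : Set (Portfolio 𝓕) :=
  {Φ | ∃ (τ : ℕ → Ω → Time T) (N : Ω → ℕ), (∀ᵐ ω ∂P, ∃ k, τ k ω = maturity hT) ∧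
    Measurable N ∧ Φ.IsStepAlong P τ N ∧ Φ.IsSelfFinancingAlong P S τ}

/-! ### Arbitrage -/

/-- Arbitrage. -/
def Portfolio.IsArbitrage (Φ : Portfolio 𝓕) (P : Measure Ω) (hT : 0 ≤ T)
    (S : Time T → Ω → ℝ) : Prop :=
  (∀ᵐ ω ∂P, Φ.value S (initialTime hT) ω = 0) ∧
  (∀ᵐ ω ∂P, 0 ≤ Φ.value S (maturity hT) ω) ∧
  0 < P {ω | 0 < Φ.value S (maturity hT) ω}

/-- Strong arbitrage. -/
def Portfolio.IsStrongArbitrage (Φ : Portfolio 𝓕) (P : Measure Ω) (hT : 0 ≤ T)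
    (S : Time T → Ω → ℝ) : Prop :=
  (∀ᵐ ω ∂P, Φ.value S (initialTime hT) ω = 0) ∧
  ∃ a : ℝ, 0 < a ∧ ∀ᵐ ω ∂P, a ≤ Φ.value S (maturity hT) ω

/-- The sequence `Φ` is approximate arbitrage, with limiting terminal value `V`. -/
def IsApproximateArbitrageWithLimit (Φ : ℕ → Portfolio 𝓕) (P : Measure Ω) (hT : 0 ≤ T)
    (S : Time T → Ω → ℝ) (V : Ω → ℝ) : Prop :=
  (∀ n, ∀ᵐ ω ∂P, (Φ n).value S (initialTime hT) ω = 0) ∧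
  Measurable V ∧
  TendstoInMeasure P (fun n => (Φ n).value S (maturity hT)) atTop V ∧
  (∀ᵐ ω ∂P, 0 ≤ V ω) ∧ 0 < P {ω | 0 < V ω}

/-- Strong approximate arbitrage. -/
def IsStrongApproximateArbitrage (Φ : ℕ → Portfolio 𝓕) (P : Measure Ω) (hT : 0 ≤ T)
    (S : Time T → Ω → ℝ) : Prop :=
  ∃ V : Ω → ℝ, IsApproximateArbitrageWithLimit Φ P hT S V ∧
    ∃ a : ℝ, 0 < a ∧ ∀ᵐ ω ∂P, a ≤ V ω

/-! ### Doubling along `t_k = T (1 - 2^{-k})` -/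

/-- The time `t_k = T (1 - 2^{-k})`. -/
noncomputable def doublingTime (hT : 0 ≤ T) (k : ℕ) : Time T :=
  ⟨T * (1 - (1 / 2) ^ k), by
    have h1 : (1 / 2 : ℝ) ^ k ≤ 1 := pow_le_one₀ (by norm_num) (by norm_num)
    have h0 : (0 : ℝ) ≤ (1 / 2) ^ k := by positivity
    exact ⟨mul_nonneg hT (by linarith), mul_le_of_le_one_right hT (by linarith)⟩⟩

/-- `τ = inf {t_k ; k ≥ 1, (S_{t_k} - S_{t_{k-1}}) / S_{t_{k-1}} ≥ c_k}`, and `T` if there is no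
such `k`. -/
noncomputable def doublingStop (hT : 0 ≤ T) (S : Time T → Ω → ℝ) (c : ℕ → ℝ) (ω : Ω) : ℝ :=
  sInf (insert T {x : ℝ | ∃ k : ℕ, x = doublingTime hT (k + 1) ∧
    c (k + 1) ≤ (S (doublingTime hT (k + 1)) ω - S (doublingTime hT k) ω) /
      S (doublingTime hT k) ω})

/-- The summand `φ_{t_k} 1_{(t_k ∧ τ, t_{k+1} ∧ τ]}(t)` with
`φ_{t_k} = (1 - V_{t_k}(Φ)) / (S_{t_k} c_{k+1})`. -/
noncomputable def doublingTerm (hT : 0 ≤ T) (S : Time T → Ω → ℝ) (c : ℕ → ℝ)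
    (Φ : Portfolio 𝓕) (k : ℕ) (t : Time T) (ω : Ω) : ℝ :=
  (Set.Ioc (min (doublingTime hT k : ℝ) (doublingStop hT S c ω))
      (min (doublingTime hT (k + 1) : ℝ) (doublingStop hT S c ω))).indicator
    (fun _ => (1 - Φ.value S (doublingTime hT k) ω) / (S (doublingTime hT k) ω * c (k + 1)))
    (t : ℝ)

/-- `Φ` is the doubling strategy with thresholds `c`: its stock position is the sum of all
doubling terms (at each time at most one of them is nonzero). -/
def Portfolio.IsDoubling (Φ : Portfolio 𝓕) (P : Measure Ω) (hT : 0 ≤ T)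
    (S : Time T → Ω → ℝ) (c : ℕ → ℝ) : Prop :=
  ∀ᵐ ω ∂P, ∀ t, Φ.stock t ω = ∑' k, doublingTerm hT S c Φ k t ω

/-- `Ψ` is the doubling strategy `Φ` truncated after the summand with index `n`. -/
def Portfolio.IsTruncatedDoubling (Ψ Φ : Portfolio 𝓕) (P : Measure Ω) (hT : 0 ≤ T)
    (S : Time T → Ω → ℝ) (c : ℕ → ℝ) (n : ℕ) : Prop :=
  ∀ᵐ ω ∂P, ∀ t, Ψ.stock t ω = ∑ k ∈ Finset.range (n + 1), doublingTerm hT S c Φ k t ω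

end BlackScholes

/-!
The price has an equivalent martingale measure, by Girsanov's change of measure. Optional sampling
turns the price at the readjustment times of a simple portfolio into a discrete-time martingale, the
terminal value of the portfolio is the sum of its gains along this martingale, and if such a sum is
almost surely nonnegative then it vanishes almost surely.

The doubling strategy stakes, in each period before the first win, as much as is needed for a
return of `c_{k+1}` to bring the total gains to `1`. The log-return over a period of length `δ` is
normal with standard deviation `σ √δ` and a drift of order `δ`, so it exceeds `σ √δ` with a
probability bounded away from zero. The returns being independent, by Borel-Cantelli there is
almost surely a win for the thresholds `c_k = exp (σ √(t_k - t_{k-1})) - 1`. The strategy is then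
worth at least `1`, and its truncations converge to it because they eventually coincide with it.
-/

namespace BlackScholes

variable {Ω : Type*} {m : MeasurableSpace Ω} {T : ℝ}

theorem initialTime_le (hT : 0 ≤ T) (t : Time T) : initialTime hT ≤ t := t.2.1

theorem le_maturity (hT : 0 ≤ T) (t : Time T) : t ≤ maturity hT := t.2.2

/-! ### Optional sampling in continuous time -/

theorem rightCont_le_of_lt {ι : Type*} [LinearOrder ι] [DenselyOrdered ι] (𝓖 : Filtration ι m)
    {s t : ι} (hst : s < t) : 𝓖.rightCont s ≤ 𝓖 t := by
  let _ := Preorder.topology ι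
  have : OrderTopology ι := ⟨rfl⟩
  rw [𝓖.rightCont_eq_of_not_isMax (not_isMax_iff.2 ⟨t, hst⟩)]
  exact iInf₂_le t hst

theorem rightCont_maturity (hT : 0 ≤ T) (𝓖 : Filtration (Time T) m) :
    𝓖.rightCont (maturity hT) = 𝓖 (maturity hT) :=
  𝓖.rightCont_eq_of_isMax fun t _ => le_maturity hT t

theorem measurableSet_inter_lt_of_rightCont {ι : Type*} [LinearOrder ι] [TopologicalSpace ι]
    [OrderTopology ι] [DenselyOrdered ι] [TopologicalSpace.SeparableSpace ι] {𝓖 : Filtration ι m}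
    {ρ : Ω → WithTop ι} (hρ : IsStoppingTime 𝓖.rightCont ρ) {A : Set Ω}
    (hA : MeasurableSet[hρ.measurableSpace] A) (t : ι) :
    MeasurableSet[𝓖 t] (A ∩ {ω | ρ ω < t}) := by
  obtain ⟨D, hD, hDd⟩ := TopologicalSpace.exists_countable_dense ι
  have h : A ∩ {ω | ρ ω < t} = ⋃ q ∈ D ∩ Iio t, A ∩ {ω | ρ ω ≤ q} := by
    ext ω
    simp only [mem_inter_iff, mem_ofPred_eq, mem_iUnion, mem_Iio, exists_prop]
    constructor
    · rintro ⟨hωA, hω⟩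
      lift ρ ω to ι using hω.ne_top with r
      obtain ⟨q, hqD, hrq, hqt⟩ := hDd.exists_between (WithTop.coe_lt_coe.1 hω)
      exact ⟨q, ⟨hqD, hqt⟩, hωA, WithTop.coe_le_coe.2 hrq.le⟩
    · rintro ⟨q, ⟨_, hqt⟩, hωA, hω⟩
      exact ⟨hωA, hω.trans_lt (WithTop.coe_lt_coe.2 hqt)⟩
  rw [h]
  exact MeasurableSet.biUnion (hD.mono inter_subset_left) fun q hq =>
    rightCont_le_of_lt 𝓖 hq.2 _ (hA.2 q)

/-- The first multiple of `1 / (n + 1)` strictly after `t`, capped at the maturity: these grids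
discretize stopping times from above. -/
noncomputable def gridCeil (n : ℕ) (t : Time T) : Time T :=
  ⟨min T ((⌊(n + 1) * (t : ℝ)⌋₊ + 1) / (n + 1)),
    le_min (t.2.1.trans t.2.2) (by positivity), min_le_left _ _⟩

theorem le_gridCeil (n : ℕ) (t : Time T) : t ≤ gridCeil n t := by
  refine le_min t.2.2 ((le_div_iff₀' (by positivity)).2 ?_)
  exact (Nat.lt_floor_add_one _).le

theorem gridCeil_le_add (n : ℕ) (t : Time T) :
    (gridCeil n t : ℝ) ≤ t + 1 / (n + 1) := by
  refine (min_le_right _ _).trans ?_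
  rw [add_div, add_le_add_iff_right, div_le_iff₀' (by positivity)]
  exact Nat.floor_le (mul_nonneg (by positivity) t.2.1)

theorem tendsto_gridCeil (t : Time T) :
    Tendsto (fun n => gridCeil n t) atTop (𝓝[≥] t) := by
  refine tendsto_nhdsWithin_iff.2 ⟨?_, Eventually.of_forall fun n => le_gridCeil n t⟩
  rw [tendsto_subtype_rng]
  refine tendsto_of_tendsto_of_tendsto_of_le_of_le tendsto_const_nhds ?_
    (fun n => le_gridCeil n t) (fun n => gridCeil_le_add n t)
  simpa using (tendsto_one_div_add_atTop_nhds_zero_nat (𝕜 := ℝ)).const_add (t : ℝ)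

theorem countable_range_gridCeil (n : ℕ) : (range (gridCeil n : Time T → Time T)).Countable := by
  have h : (range fun j : ℕ => min T (((j : ℝ) + 1) / (n + 1))).Countable := countable_range _
  refine (h.preimage Subtype.val_injective).mono ?_
  rintro _ ⟨t, rfl⟩
  exact ⟨_, rfl⟩

theorem gridCeil_le_iff {n : ℕ} {s t : Time T} (ht : (t : ℝ) < T) :
    gridCeil n s ≤ t ↔ (s : ℝ) < ⌊(n + 1) * (t : ℝ)⌋₊ / (n + 1) := by
  have hn : (0 : ℝ) < n + 1 := by positivity
  have hs : 0 ≤ (n + 1) * (s : ℝ) := mul_nonneg hn.le s.2.1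
  have ht₀ : 0 ≤ (n + 1) * (t : ℝ) := mul_nonneg hn.le t.2.1
  rw [← Subtype.coe_le_coe, gridCeil, min_le_iff, or_iff_right ht.not_ge, div_le_iff₀' hn,
    lt_div_iff₀' hn, ← Nat.floor_lt hs, ← Nat.add_one_le_iff, Nat.le_floor_iff ht₀]
  push_cast
  rfl

section StoppingTime

variable {𝓖 : Filtration (Time T) m} {ρ : Ω → Time T}
  (hρ : IsStoppingTime 𝓖.rightCont fun ω => (ρ ω : WithTop (Time T)))
include hρ

theorem measurableSet_inter_gridCeil_le (n : ℕ) {A : Set Ω}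
    (hA : MeasurableSet[hρ.measurableSpace] A) (t : Time T) :
    MeasurableSet[𝓖 t] (A ∩ {ω | gridCeil n (ρ ω) ≤ t}) := by
  have hn : (0 : ℝ) < n + 1 := by positivity
  rcases t.2.2.lt_or_eq with htT | htT
  · have hu : (⌊(n + 1) * (t : ℝ)⌋₊ : ℝ) / (n + 1) ≤ t :=
      (div_le_iff₀' hn).2 (Nat.floor_le (mul_nonneg hn.le t.2.1))
    let u : Time T := ⟨⌊(n + 1) * (t : ℝ)⌋₊ / (n + 1), by positivity, hu.trans t.2.2⟩
    have h := 𝓖.mono (show u ≤ t from hu) _ (measurableSet_inter_lt_of_rightCont hρ hA u)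
    simp only [WithTop.coe_lt_coe, ← Subtype.coe_lt_coe] at h
    simpa only [gridCeil_le_iff htT] using h
  · have hT : 0 ≤ T := t.2.1.trans t.2.2
    obtain rfl : t = maturity hT := Subtype.ext htT
    have h := hA.2 (maturity hT)
    rw [rightCont_maturity] at h
    simpa only [WithTop.coe_le_coe, le_maturity] using h

theorem isStoppingTime_gridCeil (n : ℕ) :
    IsStoppingTime 𝓖 fun ω => (gridCeil n (ρ ω) : WithTop (Time T)) := fun t => by
  simpa only [WithTop.coe_le_coe, univ_inter] using
    measurableSet_inter_gridCeil_le hρ n (@MeasurableSet.univ _ (_)) t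

theorem measurableSpace_le_gridCeil (hT : 0 ≤ T) (n : ℕ) :
    hρ.measurableSpace ≤ (isStoppingTime_gridCeil hρ n).measurableSpace := by
  refine fun A hA => ⟨le_iSup 𝓖 (maturity hT) _ ?_, fun t => ?_⟩
  · simpa [le_maturity] using measurableSet_inter_gridCeil_le hρ n hA (maturity hT)
  · simpa only [WithTop.coe_le_coe] using measurableSet_inter_gridCeil_le hρ n hA t

variable {Q : Measure Ω} [IsFiniteMeasure Q] {M : Time T → Ω → ℝ}

theorem stopped_gridCeil_ae_eq_condExp (hT : 0 ≤ T) (hM : Martingale M 𝓖 Q) (n : ℕ) :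
    (fun ω => M (gridCeil n (ρ ω)) ω) =ᵐ[Q]
      Q[M (maturity hT) | (isStoppingTime_gridCeil hρ n).measurableSpace] := by
  have : Nonempty (Time T) := ⟨maturity hT⟩
  refine hM.stoppedValue_ae_eq_condExp_of_le_const_of_countable_range (isStoppingTime_gridCeil hρ n)
    (fun ω => WithTop.coe_le_coe.2 (le_maturity hT _)) ?_
  refine ((countable_range_gridCeil (T := T) n).image WithTop.some).mono ?_
  rintro _ ⟨ω, rfl⟩
  exact mem_image_of_mem _ (mem_range_self _)

/-- The values at the discretized stopping times are conditional expectations of the terminal value,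
hence uniformly integrable, so that their almost sure convergence is a convergence in `L¹`. -/
theorem integrable_stopped_and_setIntegral_eq (hT : 0 ≤ T) (hM : Martingale M 𝓖 Q)
    (hMc : ∀ᵐ ω ∂Q, ∀ t, ContinuousWithinAt (fun t => M t ω) (Ici t) t) :
    Integrable (fun ω => M (ρ ω) ω) Q ∧ ∀ A, MeasurableSet[hρ.measurableSpace] A →
      ∫ ω in A, M (ρ ω) ω ∂Q = ∫ ω in A, M (maturity hT) ω ∂Q := by
  set X : ℕ → Ω → ℝ := fun n ω => M (gridCeil n (ρ ω)) ω
  have hX n := stopped_gridCeil_ae_eq_condExp hρ hT hM n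
  have hMT : Integrable (M (maturity hT)) Q := hM.integrable _
  have hui : UniformIntegrable X 1 Q :=
    (hMT.uniformIntegrable_condExp fun n => (isStoppingTime_gridCeil hρ n).measurableSpace_le).ae_eq
      fun n => (hX n).symm
  have hlim : ∀ᵐ ω ∂Q, Tendsto (fun n => X n ω) atTop (𝓝 (M (ρ ω) ω)) := by
    filter_upwards [hMc] with ω hω
    exact (hω (ρ ω)).tendsto.comp (tendsto_gridCeil (ρ ω))
  have hint : Integrable (fun ω => M (ρ ω) ω) Q := hui.integrable_of_ae_tendsto hlim
  refine ⟨hint, fun A hA => ?_⟩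
  have hL1 := tendsto_Lp_finite_of_tendsto_ae le_rfl ENNReal.one_ne_top
    hui.aestronglyMeasurable (memLp_one_iff_integrable.2 hint) hui.unifIntegrable hlim
  refine tendsto_nhds_unique (tendsto_setIntegral_of_L1' _ hint.1
    (Eventually.of_forall fun n => (hui.memLp n).integrable le_rfl) hL1 A)
    (tendsto_const_nhds.congr fun n => ?_)
  rw [setIntegral_congr_ae₀ (hρ.measurableSpace_le A hA).nullMeasurableSet
      ((hX n).mono fun ω hω _ => hω),
    setIntegral_condExp (isStoppingTime_gridCeil hρ n).measurableSpace_le hMT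
      (measurableSpace_le_gridCeil hρ hT n A hA)]

end StoppingTime

theorem aestronglyMeasurable_stopped {Q : Measure Ω} (hT : 0 ≤ T) {𝓕 : Filtration (Time T) m}
    (hnull : ∀ t A, Q A = 0 → MeasurableSet[𝓕 t] A) {X : Time T → Ω → ℝ}
    (hX : StronglyAdapted 𝓕 X) (hXc : ∀ᵐ ω ∂Q, Continuous fun t => X t ω) {ρ : Ω → Time T}
    (hρ : IsStoppingTime 𝓕 fun ω => (ρ ω : WithTop (Time T))) :
    AEStronglyMeasurable[hρ.measurableSpace] (fun ω => X (ρ ω) ω) Q := by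
  have : Nonempty (Time T) := ⟨maturity hT⟩
  set C : Set Ω := {ω | Continuous fun t => X t ω}
  have hC t : MeasurableSet[𝓕 t] C := (hnull t Cᶜ hXc).of_compl
  have hadapted : StronglyAdapted 𝓕 fun t => C.indicator (X t) := fun t => (hX t).indicator (hC t)
  have hcont ω : Continuous fun t => C.indicator (X t) ω := by
    by_cases hω : ω ∈ C
    · simpa only [indicator_of_mem hω] using (show Continuous fun t => X t ω from hω)
    · simpa only [indicator_of_notMem hω] using continuous_const
  refine ⟨_, (measurable_stoppedValue (hadapted.isStronglyProgressive_of_continuous hcont)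
    hρ).stronglyMeasurable, ?_⟩
  filter_upwards [hXc] with ω hω
  exact (indicator_of_mem (show ω ∈ C from hω) (X (ρ ω))).symm

theorem stopped_ae_eq_condExp {Q : Measure Ω} [IsFiniteMeasure Q] (hT : 0 ≤ T)
    {𝓖 : Filtration (Time T) m} (hnull : ∀ t A, Q A = 0 → MeasurableSet[𝓖 t] A)
    {M : Time T → Ω → ℝ} (hM : Martingale M 𝓖 Q) (hMc : ∀ᵐ ω ∂Q, Continuous fun t => M t ω)
    {ρ : Ω → Time T} (hρ : IsStoppingTime 𝓖.rightCont fun ω => (ρ ω : WithTop (Time T))) :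
    (fun ω => M (ρ ω) ω) =ᵐ[Q] Q[M (maturity hT) | hρ.measurableSpace] := by
  obtain ⟨hint, hset⟩ := integrable_stopped_and_setIntegral_eq hρ hT hM
    (hMc.mono fun ω hω t => hω.continuousWithinAt)
  have hle := 𝓖.le_rightCont
  exact ae_eq_condExp_of_forall_setIntegral_eq hρ.measurableSpace_le (hM.integrable _)
    (fun A _ _ => hint.integrableOn) (fun A hA _ => hset A hA)
    (aestronglyMeasurable_stopped hT (fun t A hA => hle t A (hnull t A hA))
      (fun t => (hM.stronglyMeasurable t).mono (hle t)) hMc hρ)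

/-! ### Nonnegative gains of a martingale vanish -/

/-- The multiplier is made bounded, without changing its sign, so that it can be pulled out of the
conditional expectation. -/
theorem mul_ae_eq_zero_of_condExp_eq_zero {Q : Measure Ω} [IsFiniteMeasure Q]
    {m₀ : MeasurableSpace Ω} (hm₀ : m₀ ≤ m) {ψ f : Ω → ℝ} (hψ : Measurable[m₀] ψ)
    (hf : Integrable f Q) (hf₀ : Q[f | m₀] =ᵐ[Q] 0) (hψf : ∀ᵐ ω ∂Q, 0 ≤ ψ ω * f ω) :
    ∀ᵐ ω ∂Q, ψ ω * f ω = 0 := by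
  have hpos (ω : Ω) : 0 < 1 + |ψ ω| := by positivity
  set g : Ω → ℝ := fun ω => ψ ω / (1 + |ψ ω|)
  have hg : StronglyMeasurable[m₀] g :=
    (hψ.div (hψ.abs.const_add 1)).stronglyMeasurable
  have hg_le (ω : Ω) : ‖g ω‖ ≤ 1 := by
    rw [Real.norm_eq_abs, abs_div, abs_of_pos (hpos ω), div_le_one (hpos ω)]
    linarith
  have hgf (ω : Ω) : (g * f) ω = ψ ω * f ω / (1 + |ψ ω|) := div_mul_eq_mul_div _ _ _
  have hint : Integrable (g * f) Q :=
    hf.bdd_mul (hg.mono hm₀).aestronglyMeasurable (ae_of_all Q hg_le)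
  have hzero : ∫ ω, (g * f) ω ∂Q = 0 := by
    rw [← integral_condExp hm₀, integral_eq_zero_of_ae]
    filter_upwards [condExp_mul_of_stronglyMeasurable_left hg hint hf, hf₀] with ω hω hω₀
    rw [hω, Pi.mul_apply, hω₀, Pi.zero_apply, mul_zero]
  have hnonneg : 0 ≤ᵐ[Q] g * f := by
    filter_upwards [hψf] with ω hω
    rw [Pi.zero_apply, hgf]
    exact div_nonneg hω (hpos ω).le
  filter_upwards [(integral_eq_zero_iff_of_nonneg_ae hnonneg hint).1 hzero] with ω hω
  rw [hgf, Pi.zero_apply] at hω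
  exact (div_eq_zero_iff.1 hω).resolve_right (hpos ω).ne'

theorem condExp_increment_ae_eq_zero {ι : Type*} [Preorder ι] {Q : Measure Ω}
    {ℱ : Filtration ι m} {X : ι → Ω → ℝ} (hX : Martingale X ℱ Q) {s t : ι} (hst : s ≤ t) :
    Q[X t - X s | ℱ s] =ᵐ[Q] 0 := by
  filter_upwards [condExp_sub (hX.integrable t) (hX.integrable s) (ℱ s),
    hX.condExp_ae_eq hst, hX.condExp_ae_eq (le_refl s)] with ω hsub ht hs
  rw [hsub, Pi.sub_apply, ht, hs, sub_self, Pi.zero_apply]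

/-- If the gains before the last period could be negative, investing in the last period only on that
event would be a one-period arbitrage. -/
theorem sum_mul_sub_ae_eq_zero_of_nonneg {Q : Measure Ω} [IsFiniteMeasure Q] {ℱ : Filtration ℕ m}
    {X φ : ℕ → Ω → ℝ} (hX : Martingale X ℱ Q) (hφ : ∀ k, Measurable[ℱ k] (φ k)) (n : ℕ)
    (h : ∀ᵐ ω ∂Q, 0 ≤ ∑ k ∈ Finset.range n, φ k ω * (X (k + 1) ω - X k ω)) :
    ∀ᵐ ω ∂Q, ∑ k ∈ Finset.range n, φ k ω * (X (k + 1) ω - X k ω) = 0 := by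
  induction n with
  | zero => simp
  | succ n ih =>
    set G : Ω → ℝ := fun ω => ∑ k ∈ Finset.range n, φ k ω * (X (k + 1) ω - X k ω)
    have hXm {k : ℕ} (hk : k ≤ n) : Measurable[ℱ n] (X k) :=
      (hX.stronglyMeasurable k).measurable.mono (ℱ.mono hk) le_rfl
    have hG : Measurable[ℱ n] G := Finset.measurable_fun_sum _ fun k hk => by
      have hkn := Finset.mem_range.1 hk
      exact ((hφ k).mono (ℱ.mono hkn.le) le_rfl).mul ((hXm hkn).sub (hXm hkn.le))
    have hlast : ∀ᵐ ω ∂Q, {ω | G ω ≤ 0}.indicator (φ n) ω * (X (n + 1) - X n) ω = 0 := by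
      refine mul_ae_eq_zero_of_condExp_eq_zero (ℱ.le n) ((hφ n).indicator (hG measurableSet_Iic))
        ((hX.integrable _).sub (hX.integrable _))
        (condExp_increment_ae_eq_zero hX n.le_succ) ?_
      filter_upwards [h] with ω hω
      rw [Finset.sum_range_succ] at hω
      by_cases hGω : G ω ≤ 0
      · rw [indicator_of_mem (show ω ∈ {ω | G ω ≤ 0} from hGω), Pi.sub_apply]
        linarith
      · rw [indicator_of_notMem (show ω ∉ {ω | G ω ≤ 0} from hGω), zero_mul]
    have hlast' : ∀ᵐ ω ∂Q, G ω ≤ 0 → φ n ω * (X (n + 1) ω - X n ω) = 0 := by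
      filter_upwards [hlast] with ω hω hGω
      rwa [indicator_of_mem (show ω ∈ {ω | G ω ≤ 0} from hGω)] at hω
    have hG_nonneg : ∀ᵐ ω ∂Q, 0 ≤ G ω := by
      filter_upwards [h, hlast'] with ω hω hω'
      rw [Finset.sum_range_succ] at hω
      by_contra! hneg
      linarith [hω' hneg.le]
    filter_upwards [ih hG_nonneg, hlast'] with ω hω hω'
    rw [Finset.sum_range_succ, hω' hω.le, add_zero]
    exact hω

/-! ### No arbitrage with simple portfolios -/

theorem sum_indicator_Ioc_apply {α : Type*} [LinearOrder α] {τ : ℕ → α} (hτ : Monotone τ)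
    (φ : ℕ → ℝ) (n : ℕ) {k : ℕ} {t : α} (ht : t ∈ Ioc (τ k) (τ (k + 1))) :
    ∑ j ∈ Finset.range n, (Ioc (τ j) (τ (j + 1))).indicator (fun _ => φ j) t =
      if k < n then φ k else 0 := by
  have hdisj {j : ℕ} (hjk : j ≠ k) : (Ioc (τ j) (τ (j + 1))).indicator (fun _ => φ j) t = 0 :=
    indicator_of_notMem
      (fun hj => disjoint_left.1 (hτ.pairwise_disjoint_on_Ioc_succ hjk) hj ht) _
  split_ifs with hk
  · rw [Finset.sum_eq_single_of_mem k (Finset.mem_range.2 hk) fun j _ => hdisj,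
      indicator_of_mem ht]
  · exact Finset.sum_eq_zero fun j hj => hdisj ((Finset.mem_range.1 hj).trans_le (not_lt.1 hk)).ne

theorem sum_indicator_Ioc_eq_zero {α : Type*} [LinearOrder α] {τ : ℕ → α} (hτ : Monotone τ)
    (φ : ℕ → ℝ) (n : ℕ) {t : α} (ht : t ≤ τ 0) :
    ∑ j ∈ Finset.range n, (Ioc (τ j) (τ (j + 1))).indicator (fun _ => φ j) t = 0 :=
  Finset.sum_eq_zero fun j _ => indicator_of_notMem
    (fun hj => (ht.trans (hτ j.zero_le)).not_gt hj.1) _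

section TerminalValue

variable {P : Measure Ω} {𝓕 : Filtration (Time T) m} {S : Time T → Ω → ℝ} {Φ : Portfolio 𝓕}
  {τ : ℕ → Ω → Time T}

theorem exists_value_eq_sum_gains {N : Ω → ℕ} (hstep : Φ.IsStepAlong P τ N)
    (hsf : Φ.IsSelfFinancingAlong P S τ) :
    ∃ hτ : ∀ k, IsStoppingTime 𝓕 fun ω => (τ k ω : WithTop (Time T)), ∃ φ : ℕ → Ω → ℝ,
      (∀ k, Measurable[(hτ k).measurableSpace] (φ k)) ∧
      ∀ᵐ ω ∂P, ∀ n, Φ.value S (τ n ω) ω = ∑ k ∈ Finset.range n,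
        (if k < N ω then φ k ω else 0) * (S (τ (k + 1) ω) ω - S (τ k ω) ω) := by
  obtain ⟨hmono, hτ, φ₀, φ, -, hφ, hbond, hstock⟩ := hstep
  refine ⟨hτ, φ, hφ, ?_⟩
  filter_upwards [hbond, hstock, ae_all_iff.2 hsf] with ω hb hs hf n
  have h0 : Φ.value S (τ 0 ω) ω = 0 := by
    rw [Portfolio.value, hb, hs, sum_indicator_Ioc_eq_zero (hmono ω) (φ₀ · ω) _ le_rfl,
      sum_indicator_Ioc_eq_zero (hmono ω) (φ · ω) _ le_rfl, zero_mul, add_zero]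
  have hgain (k : ℕ) : Φ.value S (τ (k + 1) ω) ω - Φ.value S (τ k ω) ω =
      (if k < N ω then φ k ω else 0) * (S (τ (k + 1) ω) ω - S (τ k ω) ω) := by
    rw [hf k]
    rcases (hmono ω k.le_succ).eq_or_lt with heq | hlt
    · have heq' : τ k ω = τ (k + 1) ω := heq
      rw [heq', sub_self, mul_zero, mul_zero]
    · rw [hs, sum_indicator_Ioc_apply (hmono ω) (φ · ω) _ ⟨hlt, le_rfl⟩]
  simp only [← hgain, Finset.sum_range_sub (fun k => Φ.value S (τ k ω) ω), h0, sub_zero]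

end TerminalValue

/-- The filtration `k ↦ 𝓕_{τ_k}` along a nondecreasing sequence of stopping times, as a
discrete-time filtration. -/
def sampledFiltration {𝓕 : Filtration (Time T) m} {τ : ℕ → Ω → Time T}
    (hτ : ∀ k, IsStoppingTime 𝓕 fun ω => (τ k ω : WithTop (Time T)))
    (hmono : ∀ ω, Monotone fun k => τ k ω) : Filtration ℕ m where
  seq k := (hτ k).measurableSpace
  mono' _ _ hjk := (hτ _).measurableSpace_mono (hτ _) fun ω => WithTop.coe_le_coe.2 (hmono ω hjk)
  le' k := (hτ k).measurableSpace_le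

theorem not_isArbitrage_of_martingale {P Q : Measure Ω} [IsFiniteMeasure Q] (hPQ : P ≪ Q)
    (hQP : Q ≪ P) (hT : 0 ≤ T) {𝓖 : Filtration (Time T) m}
    (hnull : ∀ t A, P A = 0 → MeasurableSet[𝓖 t] A) {S : Time T → Ω → ℝ}
    (hS : Martingale S 𝓖 Q) (hSc : ∀ᵐ ω ∂P, Continuous fun t => S t ω)
    {Φ : Portfolio 𝓖.rightCont} (hΦ : Φ ∈ simple P 𝓖.rightCont hT S) :
    ¬ Φ.IsArbitrage P hT S := by
  rintro ⟨-, hnonneg, hpos⟩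
  obtain ⟨n, τ, hn, hstep, hsf⟩ := hΦ
  obtain ⟨hτ, φ, hφ, hvalue⟩ := exists_value_eq_sum_gains hstep hsf
  have hsampled : ∀ᵐ ω ∂Q, ∀ k, S (τ k ω) ω = (Q[S (maturity hT) | (hτ k).measurableSpace]) ω :=
    ae_all_iff.2 fun k => stopped_ae_eq_condExp hT (fun t A hA => hnull t A (hPQ hA)) hS
      (hQP.ae_le hSc) (hτ k)
  have hmart := martingale_condExp (S (maturity hT)) (sampledFiltration hτ hstep.1) Q
  have hgains : ∀ᵐ ω ∂Q, Φ.value S (maturity hT) ω = ∑ k ∈ Finset.range (n + 1),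
      (if k < n then φ k ω else 0) * ((Q[S (maturity hT) | (hτ (k + 1)).measurableSpace]) ω -
        (Q[S (maturity hT) | (hτ k).measurableSpace]) ω) := by
    filter_upwards [hQP.ae_le hvalue, hsampled] with ω hω hω'
    simp only [← hω', ← hω (n + 1), hn (n + 1) n.lt_succ_self]
  have hzero := sum_mul_sub_ae_eq_zero_of_nonneg hmart
    (φ := fun k ω => if k < n then φ k ω else 0)
    (fun k => by split_ifs; exacts [hφ k, measurable_const])
    (n + 1) (by
      filter_upwards [hgains, hQP.ae_le hnonneg] with ω hω hω'
      exact hω'.trans_eq hω)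
  refine hpos.ne' (measure_mono_null ?_ (hPQ.ae_le (hgains.and hzero)))
  rintro ω hω ⟨h₁, h₂⟩
  exact (show 0 < Φ.value S (maturity hT) ω from hω).ne' (h₁.trans h₂)

/-! ### Brownian motion -/

/-- The exponential martingale of a Brownian motion `W` with exponent `a`. It serves both as density
process of the martingale measure and, for another exponent, as price process. -/
noncomputable def exponentialMartingale (a : ℝ) (W : Time T → Ω → ℝ) (t : Time T) (ω : Ω) : ℝ :=
  Real.exp (a * W t ω - a ^ 2 * t / 2)

theorem exponentialMartingale_pos (a : ℝ) (W : Time T → Ω → ℝ) (t : Time T) (ω : Ω) :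
    0 < exponentialMartingale a W t ω :=
  Real.exp_pos _

namespace IsBrownianMotion

variable {P : Measure Ω} {hT : 0 ≤ T} {W : Time T → Ω → ℝ}

theorem memLp_two (hW : IsBrownianMotion P hT W) (t : Time T) : MemLp (W t) 2 P :=
  (hW.gaussian.hasGaussianLaw_eval t).memLp_two

theorem covariance_increment (hW : IsBrownianMotion P hT W) {r s t : Time T} (hrs : r ≤ s)
    (hst : s ≤ t) : cov[W r, fun ω => W t ω - W s ω; P] = 0 := by
  have := hW.gaussian.isProbabilityMeasure
  have hrs' : (r : ℝ) ≤ s := hrs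
  have hst' : (s : ℝ) ≤ t := hst
  rw [covariance_fun_sub_right (hW.memLp_two r) (hW.memLp_two t) (hW.memLp_two s),
    hW.covariance, hW.covariance, min_eq_left hrs', min_eq_left (hrs'.trans hst'), sub_self]

theorem indepFun_past_increment (hW : IsBrownianMotion P hT W) {s t : Time T} (hst : s ≤ t) :
    IndepFun (fun ω (r : Iic s) => W r ω) (fun ω => W t ω - W s ω) P := by
  classical
  suffices h : IndepFun (fun ω (r : Iic s) => W r ω) (fun ω (_ : Unit) => W t ω - W s ω) P from
    h.comp measurable_id (measurable_pi_apply ())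
  refine IsGaussianProcess.indepFun_of_covariance_eq_zero
    (X := fun (r : Iic s) => W r) (Y := fun (_ : Unit) ω => W t ω - W s ω) ?_
    (fun r => (hW.measurable r).aemeasurable)
    (fun _ => ((hW.measurable t).sub (hW.measurable s)).aemeasurable)
    (fun r _ => hW.covariance_increment r.2 hst)
  refine hW.gaussian.of_isGaussianProcess ?_
  rintro (r | _)
  · exact ⟨{(r : Time T)},
      { toFun x := x ⟨r, by simp⟩
        map_add' := by simp
        map_smul' := by simp }, by simp⟩
  · exact ⟨{s, t},
      { toFun x := x ⟨t, by simp⟩ - x ⟨s, by simp⟩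
        map_add' x y := by simp; abel
        map_smul' c x := by simp; ring }, by simp⟩

theorem map_increment (hW : IsBrownianMotion P hT W) {s t : Time T} (hst : s ≤ t) :
    P.map (fun ω => W t ω - W s ω) = gaussianReal 0 (t - s : ℝ).toNNReal := by
  have := hW.gaussian.isProbabilityMeasure
  have hmean : ∫ ω, (W t ω - W s ω) ∂P = 0 := by
    rw [integral_sub ((hW.memLp_two t).integrable one_le_two)
      ((hW.memLp_two s).integrable one_le_two), hW.centered, hW.centered, sub_self]
  have hvar : Var[fun ω => W t ω - W s ω; P] = t - s := by
    rw [variance_fun_sub (hW.memLp_two t) (hW.memLp_two s),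
      ← covariance_self (hW.measurable t).aemeasurable,
      ← covariance_self (hW.measurable s).aemeasurable, hW.covariance, hW.covariance,
      hW.covariance, min_self, min_self, min_eq_right (show (s : ℝ) ≤ t from hst)]
    ring
  have hlaw : HasGaussianLaw (fun ω => W t ω - W s ω) P := hW.gaussian.hasGaussianLaw_fun_sub
  rw [hlaw.map_eq_gaussianReal, hmean, hvar]

theorem hasIndepIncrements (hW : IsBrownianMotion P hT W) : HasIndepIncrements W P := by
  have := hW.gaussian.isProbabilityMeasure
  refine fun n t ht => hW.gaussian.hasGaussianLaw_increments.iIndepFun_of_covariance_eq_zero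
    fun i j hij => ?_
  wlog h : i < j generalizing i j
  · rw [covariance_comm]
    exact this j i hij.symm (hij.lt_or_gt.resolve_left h)
  have hi : t i.castSucc ≤ t i.succ := ht (Fin.castSucc_le_succ i)
  have hj : t j.castSucc ≤ t j.succ := ht (Fin.castSucc_le_succ j)
  have hij : t i.succ ≤ t j.castSucc := ht (Fin.le_castSucc_iff.2 (Fin.strictMono_succ h))
  rw [covariance_fun_sub_left (hW.memLp_two _) (hW.memLp_two _)
      (show MemLp (fun ω => W (t j.succ) ω - W (t j.castSucc) ω) 2 P from
        (hW.memLp_two _).sub (hW.memLp_two _)),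
    hW.covariance_increment hij hj, hW.covariance_increment (hi.trans hij) hj, sub_self]

theorem integrable_exp_mul_increment (hW : IsBrownianMotion P hT W) {s t : Time T} (hst : s ≤ t)
    (a : ℝ) : Integrable (fun ω => Real.exp (a * (W t ω - W s ω))) P := by
  have h := integrable_exp_mul_gaussianReal (μ := 0) (v := (t - s : ℝ).toNNReal) a
  rw [← hW.map_increment hst] at h
  exact h.comp_measurable ((hW.measurable t).sub (hW.measurable s))

theorem integral_exp_mul_increment (hW : IsBrownianMotion P hT W) {s t : Time T} (hst : s ≤ t)
    (a : ℝ) : ∫ ω, Real.exp (a * (W t ω - W s ω)) ∂P = Real.exp (a ^ 2 * (t - s) / 2) := by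
  have h := mgf_gaussianReal (hW.map_increment hst) a
  rw [mgf] at h
  rw [h, Real.coe_toNNReal _ (sub_nonneg.2 (show (s : ℝ) ≤ t from hst))]
  ring_nf

theorem integrable_exp_mul (hW : IsBrownianMotion P hT W) (a : ℝ) (t : Time T) :
    Integrable (fun ω => Real.exp (a * W t ω)) P := by
  refine (hW.integrable_exp_mul_increment (initialTime_le hT t) a).congr ?_
  filter_upwards [hW.zero] with ω hω
  rw [hω, sub_zero]

theorem integrable_exp_mul_mul_exp_mul (hW : IsBrownianMotion P hT W) (a b : ℝ) (s t : Time T) :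
    Integrable (fun ω => Real.exp (a * W s ω) * Real.exp (b * W t ω)) P := by
  have hmem a t : MemLp (fun ω => Real.exp (a * W t ω)) 2 P := by
    refine (memLp_two_iff_integrable_sq (by have := hW.measurable t; fun_prop)).2 ?_
    simpa only [← Real.exp_nat_mul, ← mul_assoc, Nat.cast_ofNat]
      using hW.integrable_exp_mul (2 * a) t
  exact (hmem a s).integrable_mul (hmem b t)

theorem martingale_exponentialMartingale (hW : IsBrownianMotion P hT W) {𝓖 : Filtration (Time T) m}
    (hadapted : Adapted 𝓖 W)
    (hindep : ∀ s t, s ≤ t →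
      Indep (𝓖 s) (MeasurableSpace.comap (fun ω => W t ω - W s ω) inferInstance) P) (a : ℝ) :
    Martingale (exponentialMartingale a W) 𝓖 P := by
  have := hW.gaussian.isProbabilityMeasure
  have hexp t : exponentialMartingale a W t =
      fun ω => Real.exp (-(a ^ 2 * t / 2)) * Real.exp (a * W t ω) := by
    ext ω
    rw [exponentialMartingale, ← Real.exp_add, neg_add_eq_sub]
  have hint t : Integrable (exponentialMartingale a W t) P := by
    rw [hexp]
    exact (hW.integrable_exp_mul a t).const_mul _
  have hmeas t b : StronglyMeasurable[𝓖 t] fun ω => Real.exp (a * W t ω - b) :=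
    (Real.measurable_exp.comp (((hadapted t).const_mul a).sub_const b)).stronglyMeasurable
  refine ⟨fun t => hmeas t _, fun s t hst => ?_⟩
  have hfactor : exponentialMartingale a W t =
      (fun ω => Real.exp (a * W s ω - a ^ 2 * t / 2)) *
        fun ω => Real.exp (a * (W t ω - W s ω)) := by
    ext ω
    rw [exponentialMartingale, Pi.mul_apply, ← Real.exp_add]
    ring_nf
  have hincrement : P[fun ω => Real.exp (a * (W t ω - W s ω)) | 𝓖 s] =ᵐ[P]
      fun _ => Real.exp (a ^ 2 * (t - s) / 2) := by
    rw [← hW.integral_exp_mul_increment hst a]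
    refine condExp_indep_eq ((hW.measurable t).sub (hW.measurable s)).comap_le (𝓖.le s) ?_
      (hindep s t hst).symm
    exact ((by fun_prop : Measurable fun x => Real.exp (a * x)).comp
      (comap_measurable _)).stronglyMeasurable
  rw [hfactor]
  filter_upwards [hincrement, condExp_mul_of_stronglyMeasurable_left (hmeas s _)
    (hfactor ▸ hint t) (hW.integrable_exp_mul_increment hst a)] with ω hω hpull
  rw [hpull, Pi.mul_apply, hω, ← Real.exp_add, exponentialMartingale]
  ring_nf

end IsBrownianMotion

/-! ### Change of measure -/

theorem martingale_withDensity {ι : Type*} [Preorder ι] {P : Measure Ω} [IsFiniteMeasure P]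
    {𝓖 : Filtration ι m} {L X : ι → Ω → ℝ} {v : ι} (hv : ∀ t, t ≤ v) (hL0 : ∀ ω, 0 ≤ L v ω)
    (hL : Martingale L 𝓖 P) (hX : StronglyAdapted 𝓖 X)
    (hint : ∀ t, Integrable (L v * X t) P) (hLX : Martingale (L * X) 𝓖 P) :
    Martingale X 𝓖 (P.withDensity fun ω => ENNReal.ofReal (L v ω)) := by
  have hLv : Measurable fun ω => ENNReal.ofReal (L v ω) :=
    ((hL.stronglyMeasurable v).mono (𝓖.le v)).measurable.ennreal_ofReal
  have := isFiniteMeasure_withDensity_ofReal (hL.integrable v).2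
  have hset {s t : ι} (hst : s ≤ t) {A : Set Ω} (hA : MeasurableSet[𝓖 s] A) :
      ∫ ω in A, X t ω ∂P.withDensity (fun ω => ENNReal.ofReal (L v ω)) =
        ∫ ω in A, (L * X) s ω ∂P := by
    have hA' := 𝓖.mono hst A hA
    have hpull : P[L v * X t | 𝓖 t] =ᵐ[P] (L * X) t :=
      (condExp_mul_of_stronglyMeasurable_right (hX t) (hint t) (hL.integrable v)).trans
        ((hL.condExp_ae_eq (hv t)).mul .rfl)
    calc ∫ ω in A, X t ω ∂P.withDensity (fun ω => ENNReal.ofReal (L v ω))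
        = ∫ ω in A, (L v * X t) ω ∂P := by
          rw [setIntegral_withDensity_eq_setIntegral_toReal_smul hLv
            (ae_of_all _ fun ω => ENNReal.ofReal_lt_top) _ (𝓖.le t A hA')]
          simp only [ENNReal.toReal_ofReal (hL0 _), smul_eq_mul, Pi.mul_apply]
      _ = ∫ ω in A, (P[L v * X t | 𝓖 t]) ω ∂P := (setIntegral_condExp (𝓖.le t) (hint t) hA').symm
      _ = ∫ ω in A, (L * X) t ω ∂P := integral_congr_ae (ae_restrict_of_ae hpull)
      _ = ∫ ω in A, (L * X) s ω ∂P := (hLX.setIntegral_eq hst hA).symm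
  have hXint t : Integrable (X t) (P.withDensity fun ω => ENNReal.ofReal (L v ω)) := by
    rw [integrable_withDensity_iff_integrable_smul' hLv
      (ae_of_all _ fun ω => ENNReal.ofReal_lt_top)]
    simp only [ENNReal.toReal_ofReal (hL0 _), smul_eq_mul]
    exact hint t
  refine ⟨hX, fun s t hst => (ae_eq_condExp_of_forall_setIntegral_eq (𝓖.le s) (hXint t)
    (fun A _ _ => (hXint s).integrableOn) (fun A hA _ => ?_)
    (hX s).aestronglyMeasurable).symm⟩
  rw [hset le_rfl hA, hset hst hA]

/-! ### The augmented price filtration -/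

/-- The filtration `𝓖` with all null sets adjoined: the first of the two steps of
`usualAugmentation`. -/
noncomputable def nullAugmentation {ι : Type*} [Preorder ι] (P : Measure Ω) [P.IsComplete]
    (𝓖 : Filtration ι m) : Filtration ι m :=
  𝓖 ⊔ Filtration.const ι (MeasurableSpace.generateFrom {s : Set Ω | P s = 0})
    (MeasurableSpace.generateFrom_le fun s hs => Measure.IsComplete.out' s hs)

section NullAugmentation

variable {ι : Type*} [Preorder ι] {P : Measure Ω}

theorem le_nullAugmentation [P.IsComplete] (𝓖 : Filtration ι m) : 𝓖 ≤ nullAugmentation P 𝓖 :=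
  le_sup_left

theorem measurableSet_nullAugmentation [P.IsComplete] (𝓖 : Filtration ι m) (t : ι) {A : Set Ω}
    (hA : P A = 0) : MeasurableSet[nullAugmentation P 𝓖 t] A :=
  (le_sup_right : _ ≤ nullAugmentation P 𝓖 t) A (MeasurableSpace.measurableSet_generateFrom hA)

theorem nullAugmentation_le_eventuallyMeasurableSpace [P.IsComplete] (𝓖 : Filtration ι m) (t : ι) :
    nullAugmentation P 𝓖 t ≤ eventuallyMeasurableSpace (𝓖 t) (ae P) :=
  sup_le le_eventuallyMeasurableSpace <| MeasurableSpace.generateFrom_le fun _ hA =>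
    ⟨∅, @MeasurableSet.empty _ (𝓖 t), ae_eq_empty.2 hA⟩

theorem indep_eventuallyMeasurableSpace {m₁ m₂ : MeasurableSpace Ω} (h : Indep m₁ m₂ P) :
    Indep (eventuallyMeasurableSpace m₁ (ae P)) m₂ P := by
  rw [Indep_iff] at h ⊢
  rintro A B ⟨A', hA', hAA'⟩ hB
  rw [measure_congr hAA', measure_congr (hAA'.inter (ae_eq_refl B)), h A' B hA' hB]

end NullAugmentation

section PriceMartingale

variable {P : Measure Ω} {hT : 0 ≤ T} {s₀ μ σ : ℝ} {W : Time T → Ω → ℝ}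

/-- The filtration generated by the price process, before augmentation. -/
noncomputable abbrev naturalPriceFiltration (s₀ μ σ : ℝ) (hW : ∀ t, Measurable (W t)) :
    Filtration (Time T) m :=
  Filtration.natural (price s₀ μ σ W) fun t => (measurable_price s₀ μ σ hW t).stronglyMeasurable

theorem adapted_price (hW : ∀ t, Measurable (W t)) :
    Adapted (naturalPriceFiltration s₀ μ σ hW) (price s₀ μ σ W) :=
  fun t => (Filtration.stronglyAdapted_natural
    (fun t => (measurable_price s₀ μ σ hW t).stronglyMeasurable) t).measurable

theorem naturalPriceFiltration_le_comap (hW : ∀ t, Measurable (W t)) (t : Time T) :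
    naturalPriceFiltration s₀ μ σ hW t ≤
      MeasurableSpace.comap (fun ω (r : Iic t) => W r ω) inferInstance := by
  refine iSup₂_le fun r hr => ?_
  have h : Measurable fun x : Iic t → ℝ =>
      s₀ * Real.exp (μ * r + σ * x ⟨r, hr⟩ - σ ^ 2 * r / 2) := by fun_prop
  exact (h.comp (comap_measurable fun ω (r : Iic t) => W r ω)).comap_le

theorem adapted_naturalPriceFiltration (hs₀ : s₀ ≠ 0) (hσ : σ ≠ 0) (hW : ∀ t, Measurable (W t)) :
    Adapted (naturalPriceFiltration s₀ μ σ hW) W := by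
  intro t
  have hinv : W t = fun ω =>
      (Real.log (price s₀ μ σ W t ω / s₀) - μ * t + σ ^ 2 * t / 2) / σ := by
    ext ω
    rw [price, mul_div_cancel_left₀ _ hs₀, Real.log_exp]
    field_simp
    ring
  rw [hinv]
  have := adapted_price (s₀ := s₀) (μ := μ) (σ := σ) hW t
  fun_prop

theorem indep_nullAugmentation_increment [P.IsComplete] (hW : IsBrownianMotion P hT W)
    {s t : Time T} (hst : s ≤ t) :
    Indep (nullAugmentation P (naturalPriceFiltration s₀ μ σ hW.measurable) s)
      (MeasurableSpace.comap (fun ω => W t ω - W s ω) inferInstance) P :=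
  indep_of_indep_of_le_left (indep_eventuallyMeasurableSpace <|
      indep_of_indep_of_le_left (hW.indepFun_past_increment hst)
        (naturalPriceFiltration_le_comap hW.measurable s))
    (nullAugmentation_le_eventuallyMeasurableSpace _ s)

theorem exponentialMartingale_mul_price (hσ : σ ≠ 0) :
    exponentialMartingale (-(μ / σ)) W * price s₀ μ σ W =
      s₀ • exponentialMartingale (σ - μ / σ) W := by
  ext t ω
  simp only [exponentialMartingale, Pi.mul_apply, Pi.smul_apply, smul_eq_mul, price]
  rw [mul_left_comm, ← Real.exp_add]
  congr 2
  field_simp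
  ring

theorem integrable_exponentialMartingale_mul_price (hW : IsBrownianMotion P hT W) (a : ℝ)
    (s t : Time T) : Integrable (exponentialMartingale a W s * price s₀ μ σ W t) P := by
  convert (hW.integrable_exp_mul_mul_exp_mul a σ s t).const_mul
    (s₀ * Real.exp (-(a ^ 2 * s / 2) + (μ * t - σ ^ 2 * t / 2))) using 2 with ω
  rw [Pi.mul_apply, exponentialMartingale, price, mul_left_comm, mul_assoc, ← Real.exp_add,
    ← Real.exp_add, ← Real.exp_add]
  ring_nf

/-- The density is that of Girsanov's theorem for the market price of risk `μ / σ`. -/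
theorem exists_equivalent_martingale_measure [P.IsComplete] (hW : IsBrownianMotion P hT W)
    (hs₀ : s₀ ≠ 0) (hσ : σ ≠ 0) :
    ∃ Q : Measure Ω, IsFiniteMeasure Q ∧ P ≪ Q ∧ Q ≪ P ∧ Martingale (price s₀ μ σ W)
      (nullAugmentation P (naturalPriceFiltration s₀ μ σ hW.measurable)) Q := by
  have := hW.gaussian.isProbabilityMeasure
  set 𝓖 := nullAugmentation P (naturalPriceFiltration s₀ μ σ hW.measurable)
  have hle := le_nullAugmentation (P := P) (naturalPriceFiltration s₀ μ σ hW.measurable)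
  have hadapted : Adapted 𝓖 W := fun t =>
    (adapted_naturalPriceFiltration hs₀ hσ hW.measurable t).mono (hle t) le_rfl
  have hprice : StronglyAdapted 𝓖 (price s₀ μ σ W) := fun t =>
    ((adapted_price hW.measurable t).mono (hle t) le_rfl).stronglyMeasurable
  have hexp := hW.martingale_exponentialMartingale hadapted
    fun s t => indep_nullAugmentation_increment hW
  set L := exponentialMartingale (-(μ / σ)) W
  have hLmeas : Measurable (L (maturity hT)) :=
    (((hexp _).stronglyMeasurable (maturity hT)).mono (𝓖.le _)).measurable
  have hLprice : Martingale (L * price s₀ μ σ W) 𝓖 P := by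
    rw [exponentialMartingale_mul_price hσ]
    exact (hexp _).smul s₀
  exact ⟨P.withDensity fun ω => ENNReal.ofReal (L (maturity hT) ω),
    isFiniteMeasure_withDensity_ofReal ((hexp _).integrable _).2,
    withDensity_absolutelyContinuous' hLmeas.ennreal_ofReal.aemeasurable
      (ae_of_all _ fun ω => (ENNReal.ofReal_pos.2 (exponentialMartingale_pos _ _ _ ω)).ne'),
    withDensity_absolutelyContinuous _ _,
    martingale_withDensity (le_maturity hT) (fun ω => (exponentialMartingale_pos _ _ _ ω).le)
      (hexp _) hprice (integrable_exponentialMartingale_mul_price hW _ _) hLprice⟩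

theorem continuous_price (hW : IsBrownianMotion P hT W) :
    ∀ᵐ ω ∂P, Continuous fun t => price s₀ μ σ W t ω := by
  filter_upwards [hW.continuous] with ω hω
  unfold price
  fun_prop

theorem adapted_price_priceFiltration [P.IsComplete] (hW : ∀ t, Measurable (W t)) :
    Adapted (priceFiltration P s₀ μ σ W hW) (price s₀ μ σ W) := fun t =>
  (adapted_price hW t).mono ((le_nullAugmentation _ t).trans (Filtration.le_rightCont _ t)) le_rfl

theorem not_isArbitrage_of_mem_simple [P.IsComplete] (hW : IsBrownianMotion P hT W)
    (hs₀ : s₀ ≠ 0) (hσ : σ ≠ 0) {Φ : Portfolio (priceFiltration P s₀ μ σ W hW.measurable)}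
    (hΦ : Φ ∈ simple P (priceFiltration P s₀ μ σ W hW.measurable) hT (price s₀ μ σ W)) :
    ¬ Φ.IsArbitrage P hT (price s₀ μ σ W) := by
  obtain ⟨Q, _, hPQ, hQP, hS⟩ := exists_equivalent_martingale_measure hW hs₀ hσ (μ := μ)
  exact not_isArbitrage_of_martingale hPQ hQP hT
    (fun t A hA => measurableSet_nullAugmentation _ t hA) hS (continuous_price hW) hΦ

end PriceMartingale

/-! ### Portfolios readjusted along a grid -/

section Grid

/-- Readjustment times `0 = g 0 < g 1 < ⋯` exhausting `[0, T)`. -/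
structure IsGrid (hT : 0 ≤ T) (g : ℕ → Time T) : Prop where
  zero : g 0 = initialTime hT
  strictMono : StrictMono g
  exists_le : ∀ t < maturity hT, ∃ k, t ≤ g k

theorem isGrid_doublingTime (hT : 0 < T) : IsGrid hT.le (doublingTime hT.le) where
  zero := Subtype.ext (by simp [doublingTime, initialTime])
  strictMono := strictMono_nat_of_lt_succ fun k => by
    have h : (0 : ℝ) < (1 / 2) ^ k := by positivity
    change T * (1 - (1 / 2) ^ k) < T * (1 - (1 / 2) ^ (k + 1))
    rw [pow_succ]
    nlinarith
  exists_le t ht := by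
    have htT : (t : ℝ) < T := ht
    obtain ⟨k, hk⟩ := exists_pow_lt_of_lt_one (div_pos (sub_pos.2 htT) hT) one_half_lt_one
    rw [lt_div_iff₀ hT] at hk
    exact ⟨k, show (t : ℝ) ≤ T * (1 - (1 / 2) ^ k) by linarith⟩

variable {hT : 0 ≤ T} {g : ℕ → Time T}

namespace IsGrid

theorem lt_maturity (hg : IsGrid hT g) (k : ℕ) : g k < maturity hT :=
  (hg.strictMono k.lt_succ_self).trans_le (le_maturity hT _)

theorem eq_or_mem_Ioc (hg : IsGrid hT g) (t : Time T) :
    t = initialTime hT ∨ t = maturity hT ∨ ∃ k, t ∈ Ioc (g k) (g (k + 1)) := by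
  classical
  rcases (initialTime_le hT t).eq_or_lt with h0 | h0
  · exact .inl h0.symm
  rcases (le_maturity hT t).eq_or_lt with h1 | h1
  · exact .inr (.inl h1)
  have hex := hg.exists_le t h1
  obtain ⟨k, hk⟩ : ∃ k, Nat.find hex = k + 1 := Nat.exists_eq_succ_of_ne_zero fun h =>
    h0.not_ge (hg.zero ▸ h ▸ Nat.find_spec hex)
  exact .inr (.inr ⟨k, not_le.1 (Nat.find_min hex (by omega)), hk ▸ Nat.find_spec hex⟩)

end IsGrid

/-- The path equal to `0` at time `0`, to `y k` on `(g k, g (k + 1)]`, and to `v` at maturity: the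
form of the two components of a portfolio readjusted along the grid `g`. -/
noncomputable def stepPath (hT : 0 ≤ T) (g : ℕ → Time T) (y : ℕ → ℝ) (v : ℝ) (t : Time T) : ℝ :=
  (if t = maturity hT then v else 0) + ∑' k, (Ioc (g k) (g (k + 1))).indicator (fun _ => y k) t

section StepPath

variable (hg : IsGrid hT g) (y : ℕ → ℝ) (v : ℝ)
include hg

theorem stepPath_maturity : stepPath hT g y v (maturity hT) = v := by
  have h (k : ℕ) : maturity hT ∉ Ioc (g k) (g (k + 1)) := fun h =>
    h.2.not_gt (hg.lt_maturity _)
  simp only [stepPath, if_true, indicator_of_notMem (h _), tsum_zero, add_zero]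

theorem stepPath_initialTime : stepPath hT g y v (initialTime hT) = 0 := by
  have h (k : ℕ) : initialTime hT ∉ Ioc (g k) (g (k + 1)) := fun h =>
    h.1.not_ge (initialTime_le hT _)
  simp only [stepPath, if_neg ((initialTime_le hT _).trans_lt (hg.lt_maturity 0)).ne,
    indicator_of_notMem (h _), tsum_zero, add_zero]

theorem stepPath_of_mem {k : ℕ} {t : Time T} (ht : t ∈ Ioc (g k) (g (k + 1))) :
    stepPath hT g y v t = y k := by
  rw [stepPath, if_neg (ht.2.trans_lt (hg.lt_maturity _)).ne, zero_add, tsum_eq_single k,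
    indicator_of_mem ht]
  intro j hj
  exact indicator_of_notMem (disjoint_left.1
    (hg.strictMono.monotone.pairwise_disjoint_on_Ioc_succ hj.symm) ht) _

theorem stepPath_succ (k : ℕ) : stepPath hT g y v (g (k + 1)) = y k :=
  stepPath_of_mem hg y v ⟨hg.strictMono k.lt_succ_self, le_rfl⟩

end StepPath

theorem adapted_stepPath {𝓕 : Filtration (Time T) m} (hg : IsGrid hT g) {y : ℕ → Ω → ℝ}
    {v : Ω → ℝ} (hy : ∀ k, Measurable[𝓕 (g k)] (y k)) (hv : Measurable[𝓕 (maturity hT)] v) :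
    Adapted 𝓕 fun t ω => stepPath hT g (fun k => y k ω) (v ω) t := by
  intro t
  rcases hg.eq_or_mem_Ioc t with rfl | rfl | ⟨k, hk⟩
  · simp only [stepPath_initialTime hg]
    exact measurable_const
  · simpa only [stepPath_maturity hg] using hv
  · simp only [stepPath_of_mem hg _ _ hk]
    exact (hy k).mono (𝓕.mono hk.1.le) le_rfl

/-- The readjustment times `g 0, …, g M, T, T, …` of a trader who closes all positions at `g M`;
for `M = ⊤` the whole grid. -/
noncomputable def stoppedGrid (hT : 0 ≤ T) (g : ℕ → Time T) (M : ℕ∞) (k : ℕ) : Time T :=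
  if M < k then maturity hT else g k

theorem stoppedGrid_of_lt {M : ℕ∞} {k : ℕ} (h : M < k) : stoppedGrid hT g M k = maturity hT :=
  if_pos h

theorem stoppedGrid_of_le {M : ℕ∞} {k : ℕ} (h : k ≤ M) : stoppedGrid hT g M k = g k :=
  if_neg h.not_gt

theorem le_stoppedGrid (M : ℕ∞) (k : ℕ) : g k ≤ stoppedGrid hT g M k := by
  rw [stoppedGrid]
  split_ifs
  exacts [le_maturity hT _, le_rfl]

theorem monotone_stoppedGrid (hg : Monotone g) (M : ℕ∞) : Monotone (stoppedGrid hT g M) := by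
  intro j k hjk
  rcases lt_or_ge M k with hk | hk
  · exact stoppedGrid_of_lt (hT := hT) hk ▸ le_maturity hT _
  · rw [stoppedGrid_of_le hk, stoppedGrid_of_le ((Nat.cast_le.2 hjk).trans hk)]
    exact hg hjk

theorem stepPath_eq_sum_stoppedGrid (hg : IsGrid hT g) {M : ℕ} {y : ℕ → ℝ} {v : ℝ}
    (hy : ∀ k, M ≤ k → y k = v) (t : Time T) :
    stepPath hT g y v t = ∑ k ∈ Finset.range (M + 1),
      (Ioc (stoppedGrid hT g M k) (stoppedGrid hT g M (k + 1))).indicator (fun _ => y k) t := by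
  have hmono := monotone_stoppedGrid (hT := hT) hg.strictMono.monotone M
  have hzero : stoppedGrid hT g M 0 = initialTime hT := by
    rw [stoppedGrid_of_le zero_le, hg.zero]
  have hlast {t : Time T} (ht : g M < t) : ∑ k ∈ Finset.range (M + 1),
      (Ioc (stoppedGrid hT g M k) (stoppedGrid hT g M (k + 1))).indicator (fun _ => y k) t = v := by
    have hmem : t ∈ Ioc (stoppedGrid hT g M M) (stoppedGrid hT g M (M + 1)) := by
      rw [stoppedGrid_of_le le_rfl, stoppedGrid_of_lt (by exact_mod_cast M.lt_succ_self)]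
      exact ⟨ht, le_maturity hT t⟩
    rw [sum_indicator_Ioc_apply hmono y _ hmem, if_pos M.lt_succ_self, hy M le_rfl]
  rcases hg.eq_or_mem_Ioc t with rfl | rfl | ⟨k, hk⟩
  · rw [stepPath_initialTime hg, sum_indicator_Ioc_eq_zero hmono y _ hzero.ge]
  · rw [stepPath_maturity hg, hlast (hg.lt_maturity M)]
  rw [stepPath_of_mem hg _ _ hk]
  rcases Nat.lt_or_ge k M with hkM | hkM
  · rw [sum_indicator_Ioc_apply hmono y _ (k := k), if_pos (by omega)]
    rwa [stoppedGrid_of_le (by exact_mod_cast hkM.le), stoppedGrid_of_le (by exact_mod_cast hkM)]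
  · rw [hlast ((hg.strictMono.monotone hkM).trans_lt hk.1), hy k hkM]

section StoppedGrid

variable {𝓕 : Filtration (Time T) m} {M : Ω → ℕ∞} {k : ℕ}
  (hM : MeasurableSet[𝓕 (g k)] {ω | M ω < k})
include hM

theorem isStoppingTime_stoppedGrid :
    IsStoppingTime 𝓕 fun ω => (stoppedGrid hT g (M ω) k : WithTop (Time T)) := by
  classical
  convert isStoppingTime_piecewise_const (𝒢 := 𝓕) (le_maturity hT (g k)) hM.compl using 1
  funext ω
  by_cases hω : M ω < k
  · rw [stoppedGrid_of_lt hω, piecewise_eq_of_notMem]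
    exact notMem_compl_iff.2 hω
  · rw [stoppedGrid_of_le (not_lt.1 hω), piecewise_eq_of_mem]
    exact hω

theorem le_measurableSpace_stoppedGrid :
    𝓕 (g k) ≤ (isStoppingTime_stoppedGrid (hT := hT) hM).measurableSpace :=
  (isStoppingTime_stoppedGrid hM).le_measurableSpace_of_const_le fun _ =>
    WithTop.coe_le_coe.2 (le_stoppedGrid _ _)

end StoppedGrid

/-- The gains up to time `g k` of holding `x j` shares during `(g j, g (j + 1)]`. -/
noncomputable def gains (g : ℕ → Time T) (S : Time T → Ω → ℝ) (x : ℕ → Ω → ℝ) (k : ℕ) (ω : Ω) :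
    ℝ :=
  ∑ j ∈ Finset.range k, x j ω * (S (g (j + 1)) ω - S (g j) ω)

theorem gains_succ (g : ℕ → Time T) (S : Time T → Ω → ℝ) (x : ℕ → Ω → ℝ) (k : ℕ) (ω : Ω) :
    gains g S x (k + 1) ω = gains g S x k ω + x k ω * (S (g (k + 1)) ω - S (g k) ω) :=
  Finset.sum_range_succ _ _

theorem gains_eq_of_le {S : Time T → Ω → ℝ} {x : ℕ → Ω → ℝ} {M : ℕ} {ω : Ω}
    (hx : ∀ k, M ≤ k → x k ω = 0) {k : ℕ} (hk : M ≤ k) : gains g S x k ω = gains g S x M ω := by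
  induction k, hk using Nat.le_induction with
  | base => rfl
  | succ k hk ih => rw [gains_succ, ih, hx k hk, zero_mul, add_zero]

theorem tendsto_gains {S : Time T → Ω → ℝ} {x : ℕ → Ω → ℝ} {M : ℕ} {ω : Ω}
    (hx : ∀ k, M ≤ k → x k ω = 0) :
    Tendsto (fun k => gains g S x k ω) atTop (𝓝 (gains g S x M ω)) :=
  tendsto_const_nhds.congr' <| (eventually_ge_atTop M).mono fun _ hk => (gains_eq_of_le hx hk).symm

variable {𝓕 : Filtration (Time T) m} {S : Time T → Ω → ℝ} {x : ℕ → Ω → ℝ}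

theorem measurable_gains (hg : Monotone g) (hS : Adapted 𝓕 S)
    (hx : ∀ k, Measurable[𝓕 (g k)] (x k)) (k : ℕ) : Measurable[𝓕 (g k)] (gains g S x k) := by
  refine Finset.measurable_fun_sum _ fun j hj => ?_
  have hjk : j + 1 ≤ k := Finset.mem_range.1 hj
  have hS' {i : ℕ} (hi : i ≤ k) : Measurable[𝓕 (g k)] (S (g i)) :=
    (hS _).mono (𝓕.mono (hg hi)) le_rfl
  exact ((hx j).mono (𝓕.mono (hg (by omega))) le_rfl).mul ((hS' hjk).sub (hS' (by omega)))

/-- The self-financing portfolio with initial value `0` that holds `x k` shares during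
`(g k, g (k + 1)]`. At maturity it holds only bonds, worth the limit of the gains; the `limsup`
makes sense of this, with an irrelevant value, also where the gains diverge. -/
noncomputable def gridPortfolio (hg : IsGrid hT g) (hS : Adapted 𝓕 S)
    (hx : ∀ k, Measurable[𝓕 (g k)] (x k)) : Portfolio 𝓕 where
  bond t ω := stepPath hT g (fun k => gains g S x k ω - x k ω * S (g k) ω)
    (limsup (fun k => gains g S x k ω) atTop) t
  stock t ω := stepPath hT g (fun k => x k ω) 0 t
  adapted_bond := adapted_stepPath hg
    (fun k => (measurable_gains hg.strictMono.monotone hS hx k).sub ((hx k).mul (hS _)))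
    (Measurable.limsup fun k => (measurable_gains hg.strictMono.monotone hS hx k).mono
      (𝓕.mono (le_maturity hT _)) le_rfl)
  adapted_stock := adapted_stepPath hg hx measurable_const

section GridPortfolio

variable (hg : IsGrid hT g) (hS : Adapted 𝓕 S) (hx : ∀ k, Measurable[𝓕 (g k)] (x k))

theorem gridPortfolio_stock (t : Time T) (ω : Ω) : (gridPortfolio hg hS hx).stock t ω =
    ∑' k, (Ioc (g k) (g (k + 1))).indicator (fun _ => x k ω) t := by
  simp only [gridPortfolio, stepPath, ite_self, zero_add]

theorem gridPortfolio_stock_succ (k : ℕ) (ω : Ω) :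
    (gridPortfolio hg hS hx).stock (g (k + 1)) ω = x k ω :=
  stepPath_succ hg _ _ k

theorem gridPortfolio_stock_maturity (ω : Ω) :
    (gridPortfolio hg hS hx).stock (maturity hT) ω = 0 :=
  stepPath_maturity hg _ _

theorem gridPortfolio_value_initialTime (ω : Ω) :
    (gridPortfolio hg hS hx).value S (initialTime hT) ω = 0 := by
  simp only [Portfolio.value, gridPortfolio, stepPath_initialTime hg, zero_mul, add_zero]

theorem gridPortfolio_value_maturity {M : ℕ} {ω : Ω} (hM : ∀ k, M ≤ k → x k ω = 0) :
    (gridPortfolio hg hS hx).value S (maturity hT) ω = gains g S x M ω := by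
  simp only [Portfolio.value, gridPortfolio, stepPath_maturity hg, zero_mul, add_zero,
    (tendsto_gains hM).limsup_eq]

theorem gridPortfolio_value_grid (k : ℕ) (ω : Ω) :
    (gridPortfolio hg hS hx).value S (g k) ω = gains g S x k ω := by
  cases k with
  | zero => rw [hg.zero, gridPortfolio_value_initialTime, gains, Finset.sum_range_zero]
  | succ k =>
    simp only [Portfolio.value, gridPortfolio, stepPath_succ hg, gains_succ]
    ring

variable {P : Measure Ω} {M : Ω → ℕ∞} (hM_top : ∀ᵐ ω ∂P, M ω ≠ ⊤)
  (hxM : ∀ ω k, M ω ≤ (k : ℕ) → x k ω = 0)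
include hM_top hxM

theorem gridPortfolio_isStepAlong (hM : ∀ k : ℕ, MeasurableSet[𝓕 (g k)] {ω | M ω < k}) :
    (gridPortfolio hg hS hx).IsStepAlong P (fun k ω => stoppedGrid hT g (M ω) k)
      fun ω => (M ω).toNat + 1 := by
  have hmono := hg.strictMono.monotone
  have hle (k : ℕ) := le_measurableSpace_stoppedGrid (hT := hT) (hM k)
  refine ⟨fun ω => monotone_stoppedGrid hmono (M ω), fun k => isStoppingTime_stoppedGrid (hM k),
    fun k ω => gains g S x k ω - x k ω * S (g k) ω, x,
    fun k => ((measurable_gains hmono hS hx k).sub ((hx k).mul (hS _))).mono (hle k) le_rfl,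
    fun k => (hx k).mono (hle k) le_rfl, ?_, ?_⟩
  all_goals
    filter_upwards [hM_top] with ω hω t
    obtain ⟨n, hn⟩ := ENat.ne_top_iff_exists.1 hω
    have hxn (k : ℕ) (hk : n ≤ k) : x k ω = 0 := hxM ω k (hn ▸ Nat.cast_le.2 hk)
    rw [← hn, ENat.toNat_natCast]
    refine stepPath_eq_sum_stoppedGrid hg (fun k hk => ?_) t
  · rw [hxn k hk, zero_mul, sub_zero, (tendsto_gains hxn).limsup_eq, gains_eq_of_le hxn hk]
  · exact hxn k hk

theorem gridPortfolio_isSelfFinancingAlong :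
    (gridPortfolio hg hS hx).IsSelfFinancingAlong P S fun k ω => stoppedGrid hT g (M ω) k := by
  intro k
  filter_upwards [hM_top] with ω hω
  obtain ⟨n, hn⟩ := ENat.ne_top_iff_exists.1 hω
  have hxn (k : ℕ) (hk : n ≤ k) : x k ω = 0 := hxM ω k (hn ▸ Nat.cast_le.2 hk)
  rw [← hn]
  rcases lt_trichotomy k n with hk | rfl | hk
  · rw [stoppedGrid_of_le (by exact_mod_cast hk), stoppedGrid_of_le (by exact_mod_cast hk.le),
      gridPortfolio_value_grid, gridPortfolio_value_grid, gains_succ, gridPortfolio_stock_succ,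
      add_sub_cancel_left]
  · rw [stoppedGrid_of_lt (by exact_mod_cast k.lt_succ_self), stoppedGrid_of_le le_rfl,
      gridPortfolio_value_grid, gridPortfolio_value_maturity hg hS hx hxn,
      gridPortfolio_stock_maturity, sub_self, zero_mul]
  · rw [stoppedGrid_of_lt (by exact_mod_cast Nat.lt_succ_of_lt hk),
      stoppedGrid_of_lt (by exact_mod_cast hk), sub_self, sub_self, mul_zero]

theorem gridPortfolio_mem_almostSimple (hM : ∀ k : ℕ, MeasurableSet[𝓕 (g k)] {ω | M ω < k}) :
    gridPortfolio hg hS hx ∈ almostSimple P 𝓕 hT S := by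
  refine ⟨fun k ω => stoppedGrid hT g (M ω) k, fun ω => (M ω).toNat + 1, ?_, ?_,
    gridPortfolio_isStepAlong hg hS hx hM_top hxM hM,
    gridPortfolio_isSelfFinancingAlong hg hS hx hM_top hxM⟩
  · filter_upwards [hM_top] with ω hω
    obtain ⟨n, hn⟩ := ENat.ne_top_iff_exists.1 hω
    exact ⟨n + 1, stoppedGrid_of_lt (hn ▸ by exact_mod_cast n.lt_succ_self)⟩
  · have hM' (k : ℕ) : MeasurableSet {ω | M ω < k} := 𝓕.le _ _ (hM k)
    have hMmeas : Measurable M := ENat.measurable_iff.2 fun n => by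
      convert (hM' (n + 1)).diff (hM' n) using 1
      ext ω
      simp only [mem_preimage, mem_singleton_iff, Set.mem_sdiff, mem_ofPred_eq, not_lt,
        Nat.cast_succ, ENat.lt_natCast_add_one_iff, le_antisymm_iff]
    exact (measurable_from_top.comp hMmeas).add_const 1

end GridPortfolio

theorem gridPortfolio_mem_simple (hg : IsGrid hT g) (hS : Adapted 𝓕 S)
    (hx : ∀ k, Measurable[𝓕 (g k)] (x k)) (P : Measure Ω) {n : ℕ}
    (hxn : ∀ ω k, n ≤ k → x k ω = 0) : gridPortfolio hg hS hx ∈ simple P 𝓕 hT S := by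
  have htop : ∀ᵐ _ω : Ω ∂P, (n : ℕ∞) ≠ ⊤ := ae_of_all _ fun _ => ENat.natCast_ne_top n
  have hxM (ω : Ω) (k : ℕ) (hk : (n : ℕ∞) ≤ k) : x k ω = 0 := hxn ω k (Nat.cast_le.1 hk)
  exact ⟨n + 1, fun k _ => stoppedGrid hT g n k,
    fun k hk _ => stoppedGrid_of_lt (by exact_mod_cast n.lt_succ_self.trans hk),
    gridPortfolio_isStepAlong hg hS hx htop hxM fun _ => MeasurableSet.const _,
    gridPortfolio_isSelfFinancingAlong hg hS hx htop hxM⟩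

end Grid

/-! ### The doubling strategy -/

section Doubling

/-- The return of `S` over the grid period `(g k, g (k + 1)]`. -/
noncomputable def stepReturn (g : ℕ → Time T) (S : Time T → Ω → ℝ) (k : ℕ) (ω : Ω) : ℝ :=
  (S (g (k + 1)) ω - S (g k) ω) / S (g k) ω

/-- The number of periods up to the first win, i.e. the least `k ≥ 1` for which the return over
`(g (k - 1), g k]` reaches the threshold `c k`; it is `⊤` if there is no win. -/
noncomputable def winTime (g : ℕ → Time T) (S : Time T → Ω → ℝ) (c : ℕ → ℝ) (ω : Ω) : ℕ∞ :=
  ⨅ (k : ℕ) (_ : c (k + 1) ≤ stepReturn g S k ω), (k : ℕ∞) + 1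

/-- The amount by which the wealth of the doubling strategy at time `g k` falls short of `1`,
provided that the strategy has not won before `g k`. -/
noncomputable def shortfall (g : ℕ → Time T) (S : Time T → Ω → ℝ) (c : ℕ → ℝ) (k : ℕ) (ω : Ω) :
    ℝ :=
  ∏ j ∈ Finset.range k, (1 - stepReturn g S j ω / c (j + 1))

/-- The number of shares held by the doubling strategy during `(g k, g (k + 1)]`: a return of
exactly `c (k + 1)` makes up for the shortfall. -/
noncomputable def doublingShares (g : ℕ → Time T) (S : Time T → Ω → ℝ) (c : ℕ → ℝ) (k : ℕ)
    (ω : Ω) : ℝ :=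
  if k < winTime g S c ω then shortfall g S c k ω / (S (g k) ω * c (k + 1)) else 0

/-- The shares of the doubling strategy when it is given up at `g (n + 1)`. -/
noncomputable def truncatedShares (g : ℕ → Time T) (S : Time T → Ω → ℝ) (c : ℕ → ℝ) (n k : ℕ)
    (ω : Ω) : ℝ :=
  if k ≤ n then doublingShares g S c k ω else 0

variable {g : ℕ → Time T} {S : Time T → Ω → ℝ} {c : ℕ → ℝ} {ω : Ω}

theorem winTime_lt_iff {k : ℕ} :
    winTime g S c ω < k ↔ ∃ j, c (j + 1) ≤ stepReturn g S j ω ∧ j + 1 < k := by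
  simp only [winTime, iInf_lt_iff, exists_prop]
  norm_cast

theorem exists_winTime_eq_succ (h : winTime g S c ω ≠ ⊤) :
    ∃ j : ℕ, winTime g S c ω = (j + 1 : ℕ) ∧ c (j + 1) ≤ stepReturn g S j ω := by
  obtain ⟨n, hn⟩ := ENat.ne_top_iff_exists.1 h
  obtain ⟨j, hj, hjn⟩ := winTime_lt_iff.1 (hn ▸ Nat.cast_lt.2 n.lt_succ_self)
  have hnj : ¬ winTime g S c ω < n := hn ▸ lt_irrefl _
  rw [winTime_lt_iff] at hnj
  have : n = j + 1 := by
    by_contra hne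
    exact hnj ⟨j, hj, by omega⟩
  exact ⟨j, this ▸ hn.symm, hj⟩

theorem winTime_ne_top_iff : winTime g S c ω ≠ ⊤ ↔ ∃ k, c (k + 1) ≤ stepReturn g S k ω := by
  rw [← lt_top_iff_ne_top, winTime]
  simp only [iInf_lt_iff, exists_prop, ENat.add_lt_top, ENat.natCast_lt_top, ENat.one_lt_top,
    and_true]

theorem stepReturn_lt_of_lt_winTime {k : ℕ} (h : (k + 1 : ℕ) < winTime g S c ω) :
    stepReturn g S k ω < c (k + 1) := by
  by_contra! hk
  exact h.not_ge (iInf₂_le k hk)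

theorem doublingShares_eq_zero {k : ℕ} (h : winTime g S c ω ≤ k) : doublingShares g S c k ω = 0 :=
  if_neg h.not_gt

theorem gains_doublingShares {k : ℕ} (h : k ≤ winTime g S c ω) :
    gains g S (doublingShares g S c) k ω = 1 - shortfall g S c k ω := by
  induction k with
  | zero => simp only [gains, shortfall, Finset.range_zero, Finset.sum_empty, Finset.prod_empty,
      sub_self]
  | succ k ih =>
    have hk : k < winTime g S c ω := (Nat.cast_lt.2 k.lt_succ_self).trans_le h
    rw [gains_succ, ih hk.le, doublingShares, if_pos hk, shortfall, shortfall,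
      Finset.prod_range_succ, stepReturn]
    ring

theorem shortfall_pos_of_lt_winTime (hc : ∀ k, 0 < c k) {k : ℕ} (h : k < winTime g S c ω) :
    0 < shortfall g S c k ω := by
  refine Finset.prod_pos fun j hj => ?_
  have hjk : ((j + 1 : ℕ) : ℕ∞) ≤ k := Nat.cast_le.2 (Finset.mem_range.1 hj)
  exact sub_pos.2 ((div_lt_one (hc _)).2 (stepReturn_lt_of_lt_winTime (hjk.trans_lt h)))

theorem one_le_gains_of_winTime_eq (hc : ∀ k, 0 < c k) {M : ℕ} (hM : winTime g S c ω = M) :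
    1 ≤ gains g S (doublingShares g S c) M ω := by
  obtain ⟨j, hj, hwin⟩ := exists_winTime_eq_succ (hM ▸ ENat.natCast_ne_top M)
  obtain rfl : M = j + 1 := Nat.cast_injective (hM.symm.trans hj)
  have hpos := shortfall_pos_of_lt_winTime hc (hj ▸ Nat.cast_lt.2 j.lt_succ_self)
  have hlast : 1 - stepReturn g S j ω / c (j + 1) ≤ 0 := sub_nonpos.2 ((one_le_div (hc _)).2 hwin)
  rw [gains_doublingShares hM.ge, shortfall, Finset.prod_range_succ]
  exact (le_sub_self_iff _).2 (mul_nonpos_of_nonneg_of_nonpos hpos.le hlast)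

theorem gains_truncatedShares (n : ℕ) :
    gains g S (truncatedShares g S c n) (n + 1) ω = gains g S (doublingShares g S c) (n + 1) ω :=
  Finset.sum_congr rfl fun k hk => by
    rw [truncatedShares, if_pos (Nat.lt_succ_iff.1 (Finset.mem_range.1 hk))]

theorem truncatedShares_eq_zero {n k : ℕ} (hk : n + 1 ≤ k) : truncatedShares g S c n k ω = 0 :=
  if_neg (by omega)

section Measurability

variable {𝓕 : Filtration (Time T) m} (hg : Monotone g) (hS : Adapted 𝓕 S)
include hg hS

theorem measurable_stepReturn {j k : ℕ} (hjk : j < k) :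
    Measurable[𝓕 (g k)] (stepReturn g S j) := by
  have hS' {i : ℕ} (hi : i ≤ k) : Measurable[𝓕 (g k)] (S (g i)) :=
    (hS _).mono (𝓕.mono (hg hi)) le_rfl
  exact ((hS' hjk).sub (hS' hjk.le)).div (hS' hjk.le)

theorem measurableSet_winTime_lt {i k : ℕ} (hik : i ≤ k + 1) :
    MeasurableSet[𝓕 (g k)] {ω | winTime g S c ω < i} := by
  simp only [winTime_lt_iff, ofPred_exists, ofPred_and]
  refine .iUnion fun j => ?_
  by_cases hj : j + 1 < i
  · exact (measurable_stepReturn hg hS (by omega) measurableSet_Ici).inter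
      (MeasurableSet.const _)
  · simp only [hj, ofPred_false, inter_empty, MeasurableSet.empty]

theorem measurable_doublingShares (k : ℕ) : Measurable[𝓕 (g k)] (doublingShares g S c k) := by
  refine Measurable.ite ?_ (Measurable.div ?_ ((hS _).mul_const _)) measurable_const
  · have h := (measurableSet_winTime_lt (c := c) hg hS (le_refl (k + 1))).compl
    convert h using 1
    ext ω
    simp only [mem_compl_iff, mem_ofPred_eq, Nat.cast_succ, ENat.lt_natCast_add_one_iff, not_le]
  · exact Finset.measurable_fun_prod _ fun j hj => measurable_const.sub
      ((measurable_stepReturn hg hS (Finset.mem_range.1 hj)).div_const _)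

theorem measurable_truncatedShares (n k : ℕ) :
    Measurable[𝓕 (g k)] (truncatedShares g S c n k) := by
  unfold truncatedShares
  split_ifs
  exacts [measurable_doublingShares hg hS k, measurable_const]

end Measurability

section Portfolio

variable {hT : 0 ≤ T} {𝓕 : Filtration (Time T) m} (hg : IsGrid hT g) (hS : Adapted 𝓕 S)

/-- The doubling strategy along the grid `g` with thresholds `c`. -/
noncomputable def doublingPortfolio (c : ℕ → ℝ) : Portfolio 𝓕 :=
  gridPortfolio hg hS (measurable_doublingShares (c := c) hg.strictMono.monotone hS)

/-- The doubling strategy that is given up at `g (n + 1)`. -/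
noncomputable def truncatedPortfolio (c : ℕ → ℝ) (n : ℕ) : Portfolio 𝓕 :=
  gridPortfolio hg hS (measurable_truncatedShares (c := c) hg.strictMono.monotone hS n)

theorem truncatedPortfolio_mem_simple (P : Measure Ω) (c : ℕ → ℝ) (n : ℕ) :
    truncatedPortfolio hg hS c n ∈ simple P 𝓕 hT S :=
  gridPortfolio_mem_simple hg hS _ P fun _ _ => truncatedShares_eq_zero

theorem truncatedPortfolio_value_maturity (c : ℕ → ℝ) (n : ℕ) :
    (truncatedPortfolio hg hS c n).value S (maturity hT) =
      gains g S (doublingShares g S c) (n + 1) :=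
  funext fun _ => (gridPortfolio_value_maturity hg hS _ fun _ => truncatedShares_eq_zero).trans
    (gains_truncatedShares n)

theorem doublingPortfolio_value_maturity {M : ℕ} (hM : winTime g S c ω = M) :
    (doublingPortfolio hg hS c).value S (maturity hT) ω =
      gains g S (doublingShares g S c) M ω :=
  gridPortfolio_value_maturity hg hS _ fun _ hk =>
    doublingShares_eq_zero (hM ▸ Nat.cast_le.2 hk)

variable {P : Measure Ω} (hwin : ∀ᵐ ω ∂P, winTime g S c ω ≠ ⊤)
include hwin

theorem doublingPortfolio_mem_almostSimple :
    doublingPortfolio hg hS c ∈ almostSimple P 𝓕 hT S :=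
  gridPortfolio_mem_almostSimple hg hS _ hwin (fun _ _ => doublingShares_eq_zero)
    fun k => measurableSet_winTime_lt hg.strictMono.monotone hS k.le_succ

theorem one_le_doublingPortfolio_value_maturity (hc : ∀ k, 0 < c k) :
    ∀ᵐ ω ∂P, 1 ≤ (doublingPortfolio hg hS c).value S (maturity hT) ω := by
  filter_upwards [hwin] with ω hω
  obtain ⟨M, hM⟩ := ENat.ne_top_iff_exists.1 hω
  rw [doublingPortfolio_value_maturity hg hS hM.symm]
  exact one_le_gains_of_winTime_eq hc hM.symm

theorem doublingPortfolio_isStrongArbitrage (hc : ∀ k, 0 < c k) :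
    (doublingPortfolio hg hS c).IsStrongArbitrage P hT S :=
  ⟨ae_of_all _ (gridPortfolio_value_initialTime hg hS _), 1, one_pos,
    one_le_doublingPortfolio_value_maturity hg hS hwin hc⟩

theorem tendsto_truncatedPortfolio_value_maturity : ∀ᵐ ω ∂P,
    Tendsto (fun n => (truncatedPortfolio hg hS c n).value S (maturity hT) ω) atTop
      (𝓝 ((doublingPortfolio hg hS c).value S (maturity hT) ω)) := by
  filter_upwards [hwin] with ω hω
  obtain ⟨M, hM⟩ := ENat.ne_top_iff_exists.1 hω
  simp only [truncatedPortfolio_value_maturity, doublingPortfolio_value_maturity hg hS hM.symm]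
  exact (tendsto_add_atTop_iff_nat 1).2
    (tendsto_gains fun k hk => doublingShares_eq_zero (hM ▸ Nat.cast_le.2 hk))

theorem truncatedPortfolio_isStrongApproximateArbitrage [IsFiniteMeasure P] [NeZero P]
    (hc : ∀ k, 0 < c k) :
    IsStrongApproximateArbitrage (truncatedPortfolio hg hS c) P hT S := by
  have hmeas (Φ : Portfolio 𝓕) : Measurable (Φ.value S (maturity hT)) :=
    (((Φ.adapted_bond _).add ((Φ.adapted_stock _).mul (hS _)))).mono (𝓕.le _) le_rfl
  have hone := one_le_doublingPortfolio_value_maturity hg hS hwin hc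
  refine ⟨(doublingPortfolio hg hS c).value S (maturity hT),
    ⟨fun n => ae_of_all _ (gridPortfolio_value_initialTime hg hS _), hmeas _,
      tendstoInMeasure_of_tendsto_ae (fun n => (hmeas _).aestronglyMeasurable)
        (tendsto_truncatedPortfolio_value_maturity hg hS hwin),
      hone.mono fun ω hω => zero_le_one.trans hω, ?_⟩, 1, one_pos, hone⟩
  exact pos_iff_ne_zero.2 (frequently_ae_iff.1
    (hone.mono fun ω hω => zero_lt_one.trans_le hω).frequently)

end Portfolio

/-! ### Doubling along `t_k = T (1 - 2^{-k})` -/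

section DoublingTime

theorem le_doublingStop (hT : 0 < T) {k : ℕ}
    (h : k ≤ winTime (doublingTime hT.le) S c ω) :
    (doublingTime hT.le k : ℝ) ≤ doublingStop hT.le S c ω := by
  refine le_csInf (insert_nonempty _ _) ?_
  rintro x (rfl | ⟨j, rfl, hj⟩)
  · exact (doublingTime hT.le k).2.2
  · have hkj : (k : ℕ∞) ≤ (j + 1 : ℕ) := h.trans (iInf₂_le j hj)
    exact (isGrid_doublingTime hT).strictMono.monotone (Nat.cast_le.1 hkj)

theorem doublingStop_le (hT : 0 < T) {k : ℕ}
    (h : winTime (doublingTime hT.le) S c ω ≤ k) :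
    doublingStop hT.le S c ω ≤ doublingTime hT.le k := by
  obtain ⟨j, hj, hwin⟩ := exists_winTime_eq_succ (h.trans_lt (ENat.natCast_lt_top k)).ne
  refine csInf_le_of_le ⟨0, ?_⟩ (Or.inr ⟨j, rfl, hwin⟩)
    ((isGrid_doublingTime hT).strictMono.monotone (Nat.cast_le.1 (hj ▸ h)))
  rintro x (rfl | ⟨i, rfl, -⟩)
  exacts [hT.le, (doublingTime hT.le (i + 1)).2.1]

variable {𝓕 : Filtration (Time T) m}

theorem doublingTerm_doublingPortfolio (hT : 0 < T) (hS : Adapted 𝓕 S) (k : ℕ) (t : Time T) :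
    doublingTerm hT.le S c (doublingPortfolio (isGrid_doublingTime hT) hS c) k t ω =
      (Ioc (doublingTime hT.le k) (doublingTime hT.le (k + 1))).indicator
        (fun _ => doublingShares (doublingTime hT.le) S c k ω) t := by
  rw [doublingTerm]
  rcases lt_or_ge (k : ℕ∞) (winTime (doublingTime hT.le) S c ω) with hk | hk
  · have hk' : (k + 1 : ℕ) ≤ winTime (doublingTime hT.le) S c ω := Order.add_one_le_of_lt hk
    rw [min_eq_left (le_doublingStop hT hk.le), min_eq_left (le_doublingStop hT hk'),
      doublingPortfolio, gridPortfolio_value_grid, gains_doublingShares hk.le, sub_sub_cancel,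
      doublingShares, if_pos hk]
    rfl
  · have hk' : winTime (doublingTime hT.le) S c ω ≤ (k + 1 : ℕ) :=
      hk.trans (Nat.cast_le.2 k.le_succ)
    rw [min_eq_right (doublingStop_le hT hk), min_eq_right (doublingStop_le hT hk'), Ioc_self,
      indicator_empty, doublingShares_eq_zero hk, indicator_zero]

theorem doublingPortfolio_isDoubling (hT : 0 < T) (hS : Adapted 𝓕 S) (P : Measure Ω)
    (c : ℕ → ℝ) :
    (doublingPortfolio (isGrid_doublingTime hT) hS c).IsDoubling P hT.le S c :=
  ae_of_all _ fun ω t => (gridPortfolio_stock _ hS _ t ω).trans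
    (tsum_congr fun k => (doublingTerm_doublingPortfolio hT hS k t).symm)

theorem truncatedPortfolio_isTruncatedDoubling (hT : 0 < T) (hS : Adapted 𝓕 S)
    (P : Measure Ω) (c : ℕ → ℝ) (n : ℕ) :
    (truncatedPortfolio (isGrid_doublingTime hT) hS c n).IsTruncatedDoubling
      (doublingPortfolio (isGrid_doublingTime hT) hS c) P hT.le S c n := by
  refine ae_of_all _ fun ω t => ?_
  rw [truncatedPortfolio, gridPortfolio_stock, tsum_eq_sum (s := Finset.range (n + 1))]
  · refine Finset.sum_congr rfl fun k hk => ?_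
    rw [doublingTerm_doublingPortfolio hT, truncatedShares,
      if_pos (Nat.lt_succ_iff.1 (Finset.mem_range.1 hk))]
  · intro k hk
    rw [truncatedShares_eq_zero (not_lt.1 fun h => hk (Finset.mem_range.2 h)), indicator_zero]

end DoublingTime

end Doubling

/-! ### The first win -/

section FirstWin

theorem gaussianReal_Ici_pos (μ : ℝ) {v : NNReal} (hv : v ≠ 0) (a : ℝ) :
    0 < gaussianReal μ v (Ici a) := by
  refine pos_iff_ne_zero.2 fun h => ?_
  have hvol := gaussianReal_absolutelyContinuous' μ hv h
  simp at hvol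

theorem IsBrownianMotion.measure_mul_sqrt_le_increment {P : Measure Ω} {hT : 0 ≤ T}
    {W : Time T → Ω → ℝ} (hW : IsBrownianMotion P hT W) (a : ℝ) {s t : Time T} (hst : s < t) :
    P {ω | a * √(t - s : ℝ) ≤ W t ω - W s ω} = gaussianReal 0 1 (Ici a) := by
  have hδ : (0 : ℝ) < t - s := sub_pos.2 hst
  have hvar : NNReal.mk (√(t - s : ℝ) ^ 2) (sq_nonneg _) * 1 = (t - s : ℝ).toNNReal := by
    refine NNReal.coe_injective ?_
    rw [mul_one, Real.coe_toNNReal _ hδ.le]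
    exact Real.sq_sqrt hδ.le
  have hmap : P.map (fun ω => W t ω - W s ω) =
      (gaussianReal 0 1).map fun x => √(t - s : ℝ) * x := by
    rw [gaussianReal_map_const_mul, mul_zero, hvar, hW.map_increment hst.le]
  have hpre : (fun x : ℝ => √(t - s : ℝ) * x) ⁻¹' Ici (a * √(t - s : ℝ)) = Ici a := by
    ext x
    rw [mem_preimage, mem_Ici, mem_Ici, mul_comm a, mul_le_mul_iff_right₀ (Real.sqrt_pos.2 hδ)]
  have hmeas : Measurable fun ω => W t ω - W s ω := (hW.measurable t).sub (hW.measurable s)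
  change P ((fun ω => W t ω - W s ω) ⁻¹' Ici (a * √(t - s : ℝ))) = _
  rw [← Measure.map_apply hmeas measurableSet_Ici, hmap,
    Measure.map_apply (by fun_prop) measurableSet_Ici, hpre]

variable {s₀ μ σ : ℝ} {W : Time T → Ω → ℝ}

theorem price_sub_div_price (hs₀ : s₀ ≠ 0) (s t : Time T) (ω : Ω) :
    (price s₀ μ σ W t ω - price s₀ μ σ W s ω) / price s₀ μ σ W s ω =
      Real.exp ((μ - σ ^ 2 / 2) * (t - s) + σ * (W t ω - W s ω)) - 1 := by
  have hs : price s₀ μ σ W s ω ≠ 0 := mul_ne_zero hs₀ (Real.exp_ne_zero _)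
  have ht : price s₀ μ σ W t ω = price s₀ μ σ W s ω *
      Real.exp ((μ - σ ^ 2 / 2) * (t - s) + σ * (W t ω - W s ω)) := by
    rw [price, price, mul_assoc, ← Real.exp_add]
    congr 2
    ring
  rw [ht, sub_div, mul_div_cancel_left₀ _ hs, div_self hs]

theorem exp_sub_one_le_price_sub_div_price (hs₀ : s₀ ≠ 0) {s t : Time T} (hst : s ≤ t) {ω : Ω}
    (h : (σ + |μ - σ ^ 2 / 2| * √T) * √(t - s : ℝ) ≤ σ * (W t ω - W s ω)) :
    Real.exp (σ * √(t - s : ℝ)) - 1 ≤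
      (price s₀ μ σ W t ω - price s₀ μ σ W s ω) / price s₀ μ σ W s ω := by
  have hδ : (0 : ℝ) ≤ t - s := sub_nonneg.2 hst
  have hδT : (t - s : ℝ) ≤ √T * √(t - s : ℝ) := by
    rw [← Real.sqrt_mul (s.2.1.trans s.2.2)]
    exact Real.le_sqrt_of_sq_le (by nlinarith [s.2.1, t.2.2])
  have hdrift : -(|μ - σ ^ 2 / 2| * (√T * √(t - s : ℝ))) ≤ (μ - σ ^ 2 / 2) * (t - s) :=
    calc -(|μ - σ ^ 2 / 2| * (√T * √(t - s : ℝ)))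
      _ ≤ -(|μ - σ ^ 2 / 2| * (t - s)) := by gcongr
      _ = -|μ - σ ^ 2 / 2| * (t - s) := (neg_mul _ _).symm
      _ ≤ (μ - σ ^ 2 / 2) * (t - s) := by gcongr; exact neg_abs_le _
  rw [price_sub_div_price hs₀]
  gcongr
  linarith

/-- Increments of `W` are of the order of the square root of the period, which dominates the drift
over the period; so one and the same probability `> 0` bounds from below the probabilities that the
returns reach their thresholds. -/
theorem ae_winTime_ne_top {P : Measure Ω} {hT : 0 ≤ T} (hW : IsBrownianMotion P hT W)
    (hs₀ : s₀ ≠ 0) (hσ : 0 < σ) {g : ℕ → Time T} (hg : StrictMono g) {c : ℕ → ℝ}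
    (hc : ∀ k, c (k + 1) ≤ Real.exp (σ * √(g (k + 1) - g k : ℝ)) - 1) :
    ∀ᵐ ω ∂P, winTime g (price s₀ μ σ W) c ω ≠ ⊤ := by
  have := hW.gaussian.isProbabilityMeasure
  set a := (σ + |μ - σ ^ 2 / 2| * √T) / σ
  set A : ℕ → Set Ω := fun k =>
    {ω | a * √(g (k + 1) - g k : ℝ) ≤ W (g (k + 1)) ω - W (g k) ω} with hA
  have hmeas (k : ℕ) : MeasurableSet (A k) :=
    measurableSet_le measurable_const ((hW.measurable _).sub (hW.measurable _))
  have hindep : iIndepSet A P := (iIndepSet_iff_meas_biInter hmeas).2 fun s =>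
    (hW.hasIndepIncrements.nat hg.monotone).meas_biInter fun k _ => ⟨Ici _, measurableSet_Ici, rfl⟩
  have hsum : ∑' k, P (A k) = ⊤ := by
    simp only [hA, hW.measure_mul_sqrt_le_increment a (hg (Nat.lt_succ_self _))]
    exact ENNReal.tsum_const_eq_top_of_ne_zero (gaussianReal_Ici_pos 0 one_ne_zero a).ne'
  have hlimsup : ∀ᵐ ω ∂P, ω ∈ limsup A atTop :=
    (mem_ae_iff_prob_eq_one (MeasurableSet.measurableSet_limsup hmeas)).2
      (measure_limsup_eq_one hmeas hindep hsum)
  filter_upwards [hlimsup] with ω hω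
  obtain ⟨k, hk⟩ := (mem_limsup_iff_frequently_mem.1 hω).exists
  refine winTime_ne_top_iff.2 ⟨k, (hc k).trans
    (exp_sub_one_le_price_sub_div_price hs₀ (hg k.lt_succ_self).le ?_)⟩
  rw [← mul_div_cancel₀ (σ + |μ - σ ^ 2 / 2| * √T) hσ.ne', mul_assoc]
  exact mul_le_mul_of_nonneg_left hk hσ.le

theorem doublingTime_succ_sub (hT : 0 ≤ T) (k : ℕ) :
    (doublingTime hT (k + 1) : ℝ) - doublingTime hT k = T * (1 / 2) ^ (k + 1) := by
  simp only [doublingTime]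
  ring

/-- The thresholds `c_k = exp (σ √(t_k - t_{k-1})) - 1` of the doubling strategy, continued to
`k = 0` in such a way that `c_0` is positive as well. -/
noncomputable def doublingThreshold (T σ : ℝ) (k : ℕ) : ℝ :=
  Real.exp (σ * √(T * (1 / 2) ^ k)) - 1

theorem doublingThreshold_pos (hT : 0 < T) (hσ : 0 < σ) (k : ℕ) : 0 < doublingThreshold T σ k :=
  sub_pos.2 (Real.one_lt_exp_iff.2 (by positivity))

theorem ae_winTime_doublingThreshold_ne_top {P : Measure Ω} (hT : 0 < T)
    (hW : IsBrownianMotion P hT.le W) (hs₀ : s₀ ≠ 0) (hσ : 0 < σ) :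
    ∀ᵐ ω ∂P,
      winTime (doublingTime hT.le) (price s₀ μ σ W) (doublingThreshold T σ) ω ≠ ⊤ :=
  ae_winTime_ne_top hW hs₀ hσ (isGrid_doublingTime hT).strictMono fun k => by
    rw [doublingTime_succ_sub, doublingThreshold]

end FirstWin

end BlackScholes

open BlackScholes in
theorem mainTheorem7 {Ω : Type*} {m : MeasurableSpace Ω} (P : Measure Ω)
    [IsProbabilityMeasure P] [P.IsComplete]
    (T : ℝ) (hT : 0 < T) (s₀ μ σ : ℝ) (hs₀ : 0 < s₀) (hσ : 0 < σ)
    (W : Time T → Ω → ℝ) (hW : IsBrownianMotion P hT.le W)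
    (S : Time T → Ω → ℝ) (hS : S = price s₀ μ σ W)
    (𝓕 : Filtration (Time T) m) (h𝓕 : 𝓕 = priceFiltration P s₀ μ σ W hW.measurable) :
    -- no arbitrage with simple strategies
    (∀ Φ ∈ simple P 𝓕 hT.le S, ¬ Φ.IsArbitrage P hT.le S) ∧
    -- strong approximate arbitrage with simple strategies
    (∃ Ψ : ℕ → Portfolio 𝓕, (∀ n, Ψ n ∈ simple P 𝓕 hT.le S) ∧
      IsStrongApproximateArbitrage Ψ P hT.le S) ∧
    -- strong arbitrage with almost simple strategies
    (∃ Φ ∈ almostSimple P 𝓕 hT.le S, Φ.IsStrongArbitrage P hT.le S) ∧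
    -- both are realized by a doubling strategy along `T (1 - 2 ^ (-k))` and its truncations
    (∃ c : ℕ → ℝ, (∀ k, 0 < c k) ∧
      ∃ Φ ∈ almostSimple P 𝓕 hT.le S, ∃ Ψ : ℕ → Portfolio 𝓕,
        (∀ n, Ψ n ∈ simple P 𝓕 hT.le S) ∧
        Φ.IsDoubling P hT.le S c ∧
        (∀ n, (Ψ n).IsTruncatedDoubling Φ P hT.le S c n) ∧
        IsStrongApproximateArbitrage Ψ P hT.le S ∧
        Φ.IsStrongArbitrage P hT.le S) := by
  subst hS h𝓕
  have hg := isGrid_doublingTime hT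
  have hS := adapted_price_priceFiltration (P := P) (s₀ := s₀) (μ := μ) (σ := σ) hW.measurable
  have hc := doublingThreshold_pos hT hσ
  have hwin := ae_winTime_doublingThreshold_ne_top (μ := μ) hT hW hs₀.ne' hσ
  have hΦ := doublingPortfolio_mem_almostSimple hg hS hwin
  have hΦ_arb := doublingPortfolio_isStrongArbitrage hg hS hwin hc
  have hΨ := truncatedPortfolio_mem_simple hg hS P (doublingThreshold T σ)
  have hΨ_arb := truncatedPortfolio_isStrongApproximateArbitrage hg hS hwin hc
  exact ⟨fun _ h => not_isArbitrage_of_mem_simple hW hs₀.ne' hσ.ne' h, ⟨_, hΨ, hΨ_arb⟩,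
    ⟨_, hΦ, hΦ_arb⟩, _, hc, _, hΦ, _, hΨ, doublingPortfolio_isDoubling hT hS P _,
    truncatedPortfolio_isTruncatedDoubling hT hS P _, hΨ_arb, hΦ_arb⟩
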